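/- Let $\mathcal G$ be a $\sigma$-compact, locally compact Hausdorff étale groupoid which is ample (its topology has a basis of compact open bisections) and minimal (the only closed invariant subsets of the unit space $\mathcal G^{(0)}$ are $\emptyset$ and $\mathcal G^{(0)}$), and whose unit space $\mathcal G^{(0)}$ is compact and metrizable. Assume that $\mathcal G$ is not a non-trivial group, i.e. if $\mathcal G^{(0)}$ has only one point, then $\mathcal G=\mathcal G^{(0)}$. If $\mathcal G$ is almost elementary and fiberwise amenable, then $\mathcal G$ is almost finite in Matui's sense. Here a subset of $\mathcal G$ is a bisection if it lies in an open set on which the source map $s$ and the range map $r$ are homeomorphisms onto open subsets of $\mathcal G^{(0)}$, and products of sets are formed over composable pairs. An open multisection is a finite family of open bisections $\{C_{i,j}\}_{i,j\in F}$ with $C_{i,j}C_{j,k}=C_{i,k}$ whose levels $C_{i,i}$ are pairwise disjoint subsets of $\mathcal G^{(0)}$. An open castle is a finite family $\mathcal C=\{C^l_{i,j}: i,j\in F_l,\ l\in I\}$ of open multisections with $C^l_{i,j}C^{l'}_{i',j'}=\emptyset$ for $l\ne l'$. * $\mathcal G$ is *almost elementary* if for every compact $K$ with $\mathcal G^{(0)}\subset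 K\subset\mathcal G$, every non-empty open $O\subset\mathcal G^{(0)}$ and every open cover $\mathcal V$ of $\mathcal G^{(0)}$ there are open castles $\mathcal C=\{C^l_{i,j}: i,j\in F_l,\ l\in I\}$ and $\mathcal D=\{D^l_{i,j}: i,j\in E_l,\ l\in I\}$ with the following properties. (i) For all $l\in I$ one has $F_l\subset E_l$, $C^l_{i,j}=D^l_{i,j}$ for $i,j\in F_l$, and $K\cdot\bigsqcup_{i,j\in F_l}C^l_{i,j}\subset\bigsqcup_{i,j\in E_l}D^l_{i,j}$. (ii) Every level $D^l_{i,i}$ is contained in a member of $\mathcal V$. (iii) There are finitely many open bisections $A_1,\dots,A_n$ with $\mathcal G^{(0)}\setminus\bigsqcup_{l\in I}\bigsqcup_{i\in F_l}C^l_{i,i}\subset\bigcup_k s(A_k)$ such that the sets $r(A_k)$ are pairwise disjoint subsets of $O$. * $\mathcal G$ is *fiberwise amenable* if for every compact $K\subset\mathcal G$ and every $\epsilon>0$ there is a finite non-empty set $F\subset\mathcal G$ with $|\partial_KF|\le\epsilon|F|$, where $\partial_KF=(KF\setminus F)\cup\{x\in F: yx\in\mathcal G\setminus F\text{ for some }y\in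 K\}$. * $\mathcal G$ is *almost finite* if for every compact $K\subset\mathcal G$ and every $\epsilon>0$ there is a compact open elementary subgroupoid $\mathcal H\subset\mathcal G$ (elementary: the union of the bisections of an open castle; so $\mathcal H$ is principal) with $\mathcal H^{(0)}=\mathcal G^{(0)}$ such that $|K\mathcal Hu\setminus\mathcal Hu|<\epsilon|\mathcal Hu|$ for every $u\in\mathcal G^{(0)}$, where $\mathcal Hu=\{h\in\mathcal H: s(h)=u\}$. -/

import Mathlib

open Set Topology

namespace EtaleGpd

/-- A groupoid in arrows-only form: a set with a distinguished set of composable pairs, a product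
and an inverse. The product is a total function in the code, but every axiom and every later
definition evaluates it on composable pairs only. -/
class ArrowGroupoid (G : Type*) where
  /-- `Comp a b` says that the pair `(a, b)` is composable. -/
  Comp : G → G → Prop
  /-- The product, meaningful on composable pairs. -/
  mul : G → G → G
  /-- The inverse. -/
  inv : G → G
  comp_mul_left : ∀ {a b c : G}, Comp a b → Comp b c → Comp (mul a b) c
  comp_mul_right : ∀ {a b c : G}, Comp a b → Comp b c → Comp a (mul b c)
  mul_assoc : ∀ {a b c : G}, Comp a b → Comp b c → mul (mul a b) c = mul a (mul b c)
  comp_inv : ∀ a : G, Comp a (inv a)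
  inv_inv : ∀ a : G, inv (inv a) = a
  inv_mul_cancel_left : ∀ {a b : G}, Comp a b → mul (inv a) (mul a b) = b
  mul_inv_cancel_right : ∀ {a b : G}, Comp a b → mul (mul a b) (inv b) = a

section Algebra

variable {G : Type*} [ArrowGroupoid G]

/-- The source map `s(g) = g⁻¹ g`. -/
def src (g : G) : G := ArrowGroupoid.mul (ArrowGroupoid.inv g) g

/-- The range map `r(g) = g g⁻¹`. -/
def rng (g : G) : G := ArrowGroupoid.mul g (ArrowGroupoid.inv g)

variable (G) in
/-- The unit space `G⁽⁰⁾ = {g g⁻¹ : g ∈ G}`. -/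
def unitSpace : Set G := Set.range (rng : G → G)

/-- The product `A B = {a b : a ∈ A, b ∈ B, (a, b) composable}` of two subsets. -/
def setMul (A B : Set G) : Set G :=
  {g | ∃ a ∈ A, ∃ b ∈ B, ArrowGroupoid.Comp a b ∧ ArrowGroupoid.mul a b = g}

/-- A set `D` of units is invariant if `r(G D) = D`. -/
def IsInvariant (D : Set G) : Prop := rng '' setMul univ D = D

/-- `H` is a subgroupoid: closed under products of composable pairs and under inverses. -/
def IsSubgroupoid (H : Set G) : Prop :=
  setMul H H ⊆ H ∧ ∀ h ∈ H, ArrowGroupoid.inv h ∈ H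

/-- `A u = {a ∈ A : s(a) = u}`. -/
def fiber (A : Set G) (u : G) : Set G := {a ∈ A | src a = u}

/-- The left outer `K`-boundary `K A \ A`. -/
def outerBoundary (K A : Set G) : Set G := setMul K A \ A

/-- The left inner `K`-boundary `{x ∈ A : y x ∈ G \ A for some y ∈ K}`. -/
def innerBoundary (K A : Set G) : Set G :=
  {x ∈ A | ∃ y ∈ K, ArrowGroupoid.Comp y x ∧ ArrowGroupoid.mul y x ∉ A}

/-- The left `K`-boundary. -/
def boundary (K A : Set G) : Set G := outerBoundary K A ∪ innerBoundary K A

/-- `F` is a `(K, ε)`-Følner set: finite, non-empty, `|∂_K F| / |F| ≤ ε`. -/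
def IsFolner (K : Set G) (ε : ℝ) (F : Set G) : Prop :=
  F.Finite ∧ F.Nonempty ∧ (boundary K F).Finite ∧
    ((boundary K F).ncard : ℝ) / (F.ncard : ℝ) ≤ ε

end Algebra

section Topological

variable {G : Type*} [TopologicalSpace G] [ArrowGroupoid G]

variable (G) in
/-- The product (on the set of composable pairs) and the inverse are continuous, and the range map
is a local homeomorphism from `G` to itself. -/
class IsEtale : Prop where
  continuousOn_mul : ContinuousOn (fun p : G × G => ArrowGroupoid.mul p.1 p.2)
    {p : G × G | ArrowGroupoid.Comp p.1 p.2}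
  continuous_inv : Continuous (ArrowGroupoid.inv : G → G)
  isLocalHomeomorph_rng : IsLocalHomeomorph (rng : G → G)

/-- `B` is a bisection: it lies in an open set `U` on which `s` and `r` are homeomorphisms onto open
subsets of the unit space (which is itself open in an étale groupoid). -/
def IsBisection (B : Set G) : Prop :=
  ∃ U : Set G, IsOpen U ∧ B ⊆ U ∧
    IsOpenEmbedding (fun g : U => src (g : G)) ∧ IsOpenEmbedding (fun g : U => rng (g : G))

variable (G) in
/-- The topology has a basis of compact open bisections. -/
def IsAmple : Prop :=
  TopologicalSpace.IsTopologicalBasis {B : Set G | IsCompact B ∧ IsOpen B ∧ IsBisection B}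

variable (G) in
/-- The only closed invariant sets of units are `∅` and the whole unit space (the unit space of
a Hausdorff groupoid is closed, so closedness may be tested in `G`). -/
def IsMinimal : Prop :=
  ∀ D : Set G, D ⊆ unitSpace G → IsClosed D → IsInvariant D → D = ∅ ∨ D = unitSpace G

variable (G) in
/-- Every compact `K` and every `ε > 0` admit a `(K, ε)`-Følner set. -/
def IsFiberwiseAmenable : Prop :=
  ∀ K : Set G, IsCompact K → ∀ ε : ℝ, 0 < ε → ∃ F : Set G, IsFolner K ε F

/-- `K ≺ V`: there are finitely many open bisections whose sources cover `K` and whose ranges are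
pairwise disjoint subsets of `V`. -/
def Subordinate (K V : Set G) : Prop :=
  ∃ (n : ℕ) (A : Fin n → Set G), (∀ k, IsOpen (A k) ∧ IsBisection (A k)) ∧
    K ⊆ ⋃ k, src '' A k ∧
    Pairwise (fun k k' => Disjoint (rng '' A k) (rng '' A k')) ∧
    ⋃ k, rng '' A k ⊆ V

/-- A multisection `{C i j : i, j ∈ F}`, with finite index set `F`. -/
structure IsMultisection (F : Finset ℕ) (C : ℕ → ℕ → Set G) : Prop where
  bisection : ∀ i ∈ F, ∀ j ∈ F, IsBisection (C i j)
  mul_eq : ∀ i ∈ F, ∀ j ∈ F, ∀ k ∈ F, setMul (C i j) (C j k) = C i k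
  level_subset : ∀ i ∈ F, C i i ⊆ unitSpace G
  level_disjoint : ∀ i ∈ F, ∀ j ∈ F, i ≠ j → Disjoint (C i i) (C j j)

/-- An open castle `{C l i j : i, j ∈ F l, l < m}`: a finite disjoint family of multisections all
of whose bisections are open. -/
structure IsOpenCastle {m : ℕ} (F : Fin m → Finset ℕ) (C : Fin m → ℕ → ℕ → Set G) : Prop where
  multisection : ∀ l, IsMultisection (F l) (C l)
  disjoint : ∀ l l', l ≠ l' → ∀ i ∈ F l, ∀ j ∈ F l, ∀ i' ∈ F l', ∀ j' ∈ F l',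
    setMul (C l i j) (C l' i' j') = ∅
  isOpen : ∀ l, ∀ i ∈ F l, ∀ j ∈ F l, IsOpen (C l i j)

/-- The union of all bisections of one multisection. -/
def multisectionUnion (F : Finset ℕ) (C : ℕ → ℕ → Set G) : Set G :=
  ⋃ i ∈ F, ⋃ j ∈ F, C i j

/-- The union of all levels of a castle. -/
def levelUnion {m : ℕ} (F : Fin m → Finset ℕ) (C : Fin m → ℕ → ℕ → Set G) : Set G :=
  ⋃ l, ⋃ i ∈ F l, C l i i

/-- The castle `C` is `K`-extendable to the castle `D`: `C` is a sub-castle of `D`, multisection by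
multisection, and `K` times the `l`-th multisection of `C` lies in the `l`-th multisection
of `D`. -/
def IsExtendableTo (K : Set G) {m : ℕ} (F : Fin m → Finset ℕ) (C : Fin m → ℕ → ℕ → Set G)
    (E : Fin m → Finset ℕ) (D : Fin m → ℕ → ℕ → Set G) : Prop :=
  ∀ l, F l ⊆ E l ∧ (∀ i ∈ F l, ∀ j ∈ F l, C l i j = D l i j) ∧
    setMul K (multisectionUnion (F l) (C l)) ⊆ multisectionUnion (E l) (D l)

variable (G) in
/-- Almost elementariness. -/
def IsAlmostElementary : Prop :=
  ∀ K : Set G, IsCompact K → unitSpace G ⊆ K →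
  ∀ O : Set G, IsOpen O → O ⊆ unitSpace G → O.Nonempty →
  ∀ 𝒱 : Set (Set G), (∀ V ∈ 𝒱, IsOpen V ∧ V ⊆ unitSpace G) → unitSpace G ⊆ ⋃₀ 𝒱 →
  ∃ (m : ℕ) (F E : Fin m → Finset ℕ) (C D : Fin m → ℕ → ℕ → Set G),
    IsOpenCastle F C ∧ IsOpenCastle E D ∧
    IsExtendableTo K F C E D ∧
    (∀ l, ∀ i ∈ E l, ∃ V ∈ 𝒱, D l i i ⊆ V) ∧
    Subordinate (unitSpace G \ levelUnion F C) O

/-- An elementary groupoid: the (disjoint) union of the bisections of an open castle. -/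
def IsElementary (H : Set G) : Prop :=
  ∃ (m : ℕ) (F : Fin m → Finset ℕ) (C : Fin m → ℕ → ℕ → Set G),
    IsOpenCastle F C ∧ H = ⋃ l, multisectionUnion (F l) (C l)

variable (G) in
/-- Almost finiteness in the sense of Matui: `H` is a compact open elementary subgroupoid with
`H⁽⁰⁾ = G⁽⁰⁾` and `|K H u \ H u| < ε |H u|` for all units `u`. -/
def IsAlmostFinite : Prop :=
  ∀ K : Set G, IsCompact K → ∀ ε : ℝ, 0 < ε →
  ∃ H : Set G, IsSubgroupoid H ∧ IsCompact H ∧ IsOpen H ∧ IsElementary H ∧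
    H ∩ unitSpace G = unitSpace G ∧
    ∀ u ∈ unitSpace G,
      (fiber H u).Finite ∧ (setMul K (fiber H u) \ fiber H u).Finite ∧
      ((setMul K (fiber H u) \ fiber H u).ncard : ℝ) < ε * ((fiber H u).ncard : ℝ)

end Topological

end EtaleGpd

open EtaleGpd

/-! A castle is encoded by a single compact open set `T` of arrows on which `rng` is injective. The
fibers `fiber T u` are its columns, `rng '' T` is the union of its levels, and the groupoid it
generates is `T T⁻¹`. Almost finiteness then asks for such a `T` whose levels fill the unit space
and whose columns have small boundary (`isAlmostFinite_of_columns`). Because the groupoid is ample,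
a choice made in one fiber extends to nearby fibers and local choices glue (`IsAmple.exists_lift`,
`IsAmple.exists_glue`), so the work is finite combinatorics in single fibers.

Følner columns come from both hypotheses together. Minimality spreads one Følner set to all fibers.
A growth argument and a maximal disjoint packing then enlarge any finite set `M` to a Følner set
inside `L M`, with `L` independent of `M` (`exists_folner_superset`). Extendability of the castle by
`L` leaves room for this enlargement, so the columns of an almost elementary castle can be made
Følner, and the part `R` missed by the levels still embeds into a prescribed small open set
(`exists_folner_columns`).

It remains to absorb `R`. Mark in each column of `T` a proportion of about `δ` of its points, and
call the marked set `P`. If `R` embeds into `rng '' P`, the missing points can be attached to the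
columns, which lengthens each by a factor of at most `1 + δ` and keeps it almost invariant
(`exists_absorbing_columns`). The embedding is found with a second Følner castle, invariant under `T
T⁻¹` as well. Each of its columns contains few points of `R` and a definite proportion of points of
`rng '' P`, so columnwise counting matches `R` with part of `rng '' P`. What the second castle
misses goes into a small set reserved inside `rng '' P` (`embeds_of_isSmall`).

Smallness of an open set means that it has `N` disjoint copies, which needs infinite orbits. A
finite unit space is therefore treated separately: there a whole source fiber serves as `T`. -/

namespace EtaleGpd

infixl:70 " ⋆ " => ArrowGroupoid.mul
postfix:max "†" => ArrowGroupoid.inv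

/-! ### Groupoid algebra in terms of source and range -/

section AlgebraLemmas

variable {G : Type*} [ArrowGroupoid G]

theorem inv_inv (a : G) : a†† = a := ArrowGroupoid.inv_inv a

theorem comp_inv_self (a : G) : ArrowGroupoid.Comp a† a := by
  simpa [inv_inv] using ArrowGroupoid.comp_inv a†

theorem rng_mul_self (a : G) : rng a ⋆ a = a := by
  have := ArrowGroupoid.mul_inv_cancel_right (ArrowGroupoid.comp_inv a)
  rwa [inv_inv] at this

/-- Cancellation gives `src a ⋆ b = b`, and cancelling `b` on the right then identifies `src a` with
`rng b`. Conversely, a common unit between `a` and `b` can be inserted and absorbed into `b`. -/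
theorem comp_iff {a b : G} : ArrowGroupoid.Comp a b ↔ src a = rng b := by
  constructor
  · intro h
    have h1 : src a ⋆ b = b := by
      rw [src, ArrowGroupoid.mul_assoc (comp_inv_self a) h,
        ArrowGroupoid.inv_mul_cancel_left h]
    have h2 := ArrowGroupoid.mul_inv_cancel_right
      (ArrowGroupoid.comp_mul_left (comp_inv_self a) h)
    change (src a ⋆ b) ⋆ b† = src a at h2
    rw [h1] at h2
    exact h2.symm
  · intro h
    have h1 : ArrowGroupoid.Comp a (src a) :=
      ArrowGroupoid.comp_mul_right (ArrowGroupoid.comp_inv a) (comp_inv_self a)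
    rw [h] at h1
    have h2 : ArrowGroupoid.Comp (rng b) b :=
      ArrowGroupoid.comp_mul_left (ArrowGroupoid.comp_inv b) (comp_inv_self b)
    simpa [rng_mul_self] using ArrowGroupoid.comp_mul_right h1 h2

theorem src_inv (a : G) : src a† = rng a := by
  rw [src, inv_inv, rng]

theorem rng_inv (a : G) : rng a† = src a := by
  rw [rng, inv_inv, src]

theorem src_mul {a b : G} (h : src a = rng b) : src (a ⋆ b) = src b := by
  have h1 := ArrowGroupoid.comp_mul_left (comp_iff.2 h) (ArrowGroupoid.comp_inv b)
  rw [comp_iff.1 h1, rng_inv]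

theorem rng_mul {a b : G} (h : src a = rng b) : rng (a ⋆ b) = rng a := by
  have h1 := ArrowGroupoid.comp_mul_right (comp_inv_self a) (comp_iff.2 h)
  rw [← comp_iff.1 h1, src_inv]

theorem assoc {a b c : G} (h : src a = rng b) (h' : src b = rng c) :
    a ⋆ b ⋆ c = a ⋆ (b ⋆ c) :=
  ArrowGroupoid.mul_assoc (comp_iff.2 h) (comp_iff.2 h')

theorem inv_mul_cancel_left {a b : G} (h : src a = rng b) : a† ⋆ (a ⋆ b) = b :=
  ArrowGroupoid.inv_mul_cancel_left (comp_iff.2 h)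

theorem mul_inv_cancel_right {a b : G} (h : src a = rng b) : a ⋆ b ⋆ b† = a :=
  ArrowGroupoid.mul_inv_cancel_right (comp_iff.2 h)

theorem mul_inv_cancel_left {a b : G} (h : rng a = rng b) : a ⋆ (a† ⋆ b) = b := by
  simpa [inv_inv] using inv_mul_cancel_left (a := a†) (b := b) (by rw [src_inv, h])

theorem inv_mul_cancel_right {a b : G} (h : src a = src b) : a ⋆ b† ⋆ b = a := by
  simpa [inv_inv] using mul_inv_cancel_right (a := a) (b := b†) (by rw [rng_inv, h])

theorem mul_left_cancel {a b c : G} (hb : src a = rng b) (hc : src a = rng c)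
    (h : a ⋆ b = a ⋆ c) : b = c := by
  rw [← inv_mul_cancel_left hb, h, inv_mul_cancel_left hc]

theorem mul_right_cancel {a b c : G} (ha : src a = rng c) (hb : src b = rng c)
    (h : a ⋆ c = b ⋆ c) : a = b := by
  rw [← mul_inv_cancel_right ha, h, mul_inv_cancel_right hb]

theorem rng_mem (a : G) : rng a ∈ unitSpace G := ⟨a, rfl⟩

theorem src_mem (a : G) : src a ∈ unitSpace G := ⟨a†, rng_inv a⟩

theorem src_rng (a : G) : src (rng a) = rng a := by
  rw [rng, src_mul (by rw [rng_inv]), src_inv, rng]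

theorem rng_rng (a : G) : rng (rng a) = rng a := by
  conv_lhs => rw [rng.eq_1 a, rng_mul (by rw [rng_inv])]

theorem rng_unit {u : G} (h : u ∈ unitSpace G) : rng u = u := by
  obtain ⟨a, rfl⟩ := h; exact rng_rng a

theorem src_unit {u : G} (h : u ∈ unitSpace G) : src u = u := by
  obtain ⟨a, rfl⟩ := h; exact src_rng a

theorem inv_mul_rev {a b : G} (h : src a = rng b) : (a ⋆ b)† = b† ⋆ a† := by
  have hab : src (a ⋆ b) = src b := src_mul h
  refine mul_left_cancel (a := a ⋆ b) (by rw [rng_inv]) ?_ ?_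
  · rw [rng_mul (by rw [src_inv, rng_inv, h]), rng_inv, hab]
  · rw [← assoc (by rw [hab, rng_inv]) (by rw [src_inv, rng_inv, h]), mul_inv_cancel_right h]
    exact rng_mul h

theorem mem_setMul {A B : Set G} {g : G} :
    g ∈ setMul A B ↔ ∃ a ∈ A, ∃ b ∈ B, src a = rng b ∧ a ⋆ b = g := by
  simp only [setMul, mem_ofPred_eq, comp_iff]

theorem mul_mem_setMul {A B : Set G} {a b : G} (ha : a ∈ A) (hb : b ∈ B) (h : src a = rng b) :
    a ⋆ b ∈ setMul A B := mem_setMul.2 ⟨a, ha, b, hb, h, rfl⟩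

theorem setMul_mono {A A' B B' : Set G} (hA : A ⊆ A') (hB : B ⊆ B') :
    setMul A B ⊆ setMul A' B' := by
  rintro g ⟨a, ha, b, hb, h⟩
  exact ⟨a, hA ha, b, hB hb, h⟩

theorem setMul_assoc (A B C : Set G) : setMul (setMul A B) C = setMul A (setMul B C) := by
  ext g
  constructor
  · intro hg
    obtain ⟨x, hx, c, hc, h, rfl⟩ := mem_setMul.1 hg
    obtain ⟨a, ha, b, hb, h', rfl⟩ := mem_setMul.1 hx
    rw [src_mul h'] at h
    rw [assoc h' h]
    exact mul_mem_setMul ha (mul_mem_setMul hb hc h) (by rw [rng_mul h, h'])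
  · intro hg
    obtain ⟨a, ha, x, hx, h, rfl⟩ := mem_setMul.1 hg
    obtain ⟨b, hb, c, hc, h', rfl⟩ := mem_setMul.1 hx
    rw [rng_mul h'] at h
    rw [← assoc h h']
    exact mul_mem_setMul (mul_mem_setMul ha hb h) hc (by rw [src_mul h, h'])

theorem setMul_union_left (A B C : Set G) : setMul (A ∪ B) C = setMul A C ∪ setMul B C := by
  ext g
  simp only [mem_setMul, mem_union]
  constructor
  · rintro ⟨a, ha | ha, h⟩
    exacts [Or.inl ⟨a, ha, h⟩, Or.inr ⟨a, ha, h⟩]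
  · rintro (⟨a, ha, h⟩ | ⟨a, ha, h⟩)
    exacts [⟨a, Or.inl ha, h⟩, ⟨a, Or.inr ha, h⟩]

theorem setMul_union_right (A B C : Set G) : setMul A (B ∪ C) = setMul A B ∪ setMul A C := by
  ext g
  simp only [mem_setMul, mem_union]
  constructor
  · rintro ⟨a, ha, b, hb | hb, h⟩
    exacts [Or.inl ⟨a, ha, b, hb, h⟩, Or.inr ⟨a, ha, b, hb, h⟩]
  · rintro (⟨a, ha, b, hb, h⟩ | ⟨a, ha, b, hb, h⟩)
    exacts [⟨a, ha, b, Or.inl hb, h⟩, ⟨a, ha, b, Or.inr hb, h⟩]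

theorem subset_setMul {K : Set G} (hK : unitSpace G ⊆ K) (A : Set G) : A ⊆ setMul K A := by
  intro a ha
  have := mul_mem_setMul (hK (rng_mem a)) ha (src_rng a)
  rwa [rng_mul_self] at this

theorem fiber_setMul (A B : Set G) (u : G) : fiber (setMul A B) u = setMul A (fiber B u) := by
  ext g
  constructor
  · rintro ⟨hg, rfl⟩
    obtain ⟨a, ha, b, hb, h, rfl⟩ := mem_setMul.1 hg
    exact mul_mem_setMul ha ⟨hb, (src_mul h).symm⟩ h
  · intro hg
    obtain ⟨a, ha, b, ⟨hb, rfl⟩, h, rfl⟩ := mem_setMul.1 hg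
    exact ⟨mul_mem_setMul ha hb h, src_mul h⟩

/-- The set of inverses of the elements of `A`. -/
def setInv (A : Set G) : Set G := {g | g† ∈ A}

theorem inv_mem_setInv {A : Set G} {a : G} (ha : a ∈ A) : a† ∈ setInv A := by
  simpa [setInv, inv_inv] using ha

theorem src_mul_inv {a b : G} (h : src a = src b) : src (a ⋆ b†) = rng b := by
  rw [src_mul (by rw [rng_inv, h]), src_inv]

theorem rng_mul_inv {a b : G} (h : src a = src b) : rng (a ⋆ b†) = rng a := by
  rw [rng_mul (by rw [rng_inv, h])]

theorem mul_inv_mul_mul_inv {a b c : G} (h : src a = src b) (h' : src b = src c) :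
    (a ⋆ b†) ⋆ (b ⋆ c†) = a ⋆ c† := by
  rw [← assoc (by rw [src_mul_inv h]) (by rw [rng_inv, h']), inv_mul_cancel_right h]

theorem inv_mul_inv {a b : G} (h : src a = src b) : (a ⋆ b†)† = b ⋆ a† := by
  rw [inv_mul_rev (by rw [rng_inv, h]), inv_inv]

theorem mem_setMul_setInv {A B : Set G} {g : G} :
    g ∈ setMul A (setInv B) ↔ ∃ a ∈ A, ∃ b ∈ B, src a = src b ∧ a ⋆ b† = g := by
  rw [mem_setMul]
  constructor
  · rintro ⟨a, ha, q, hq, h, rfl⟩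
    exact ⟨a, ha, q†, hq, by rw [src_inv, h], by rw [inv_inv]⟩
  · rintro ⟨a, ha, b, hb, h, rfl⟩
    exact ⟨a, ha, b†, inv_mem_setInv hb, by rw [rng_inv, h], rfl⟩

end AlgebraLemmas

/-! ### Compact open sets and their fibers in an ample groupoid -/

section TopologicalTools

set_option linter.unusedSectionVars false

variable {G : Type*} [TopologicalSpace G] [ArrowGroupoid G]

/-- `A` is compact and open. -/
structure IsCompactOpen {Y : Type*} [TopologicalSpace Y] (A : Set Y) : Prop where
  isCompact : IsCompact A
  isOpen : IsOpen A

namespace IsCompactOpen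

variable {Y : Type*} [TopologicalSpace Y] {A B : Set Y}

theorem empty : IsCompactOpen (∅ : Set Y) := ⟨isCompact_empty, isOpen_empty⟩

theorem union (hA : IsCompactOpen A) (hB : IsCompactOpen B) : IsCompactOpen (A ∪ B) :=
  ⟨hA.1.union hB.1, hA.2.union hB.2⟩

theorem inter_isClopen (hA : IsCompactOpen A) (hB : IsClopen B) : IsCompactOpen (A ∩ B) :=
  ⟨hA.1.inter_right hB.1, hA.2.inter hB.2⟩

theorem isClopen [T2Space Y] (hA : IsCompactOpen A) : IsClopen A := ⟨hA.1.isClosed, hA.2⟩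

theorem inter [T2Space Y] (hA : IsCompactOpen A) (hB : IsCompactOpen B) :
    IsCompactOpen (A ∩ B) := hA.inter_isClopen hB.isClopen

theorem diff [T2Space Y] (hA : IsCompactOpen A) (hB : IsCompactOpen B) :
    IsCompactOpen (A \ B) := hA.inter_isClopen hB.isClopen.compl

theorem eventually_mem_iff [T2Space Y] (hA : IsCompactOpen A) (u : Y) :
    ∀ᶠ v in 𝓝 u, (v ∈ A ↔ u ∈ A) := by
  by_cases h : u ∈ A
  · filter_upwards [hA.2.mem_nhds h] with v hv using by simp [hv, h]
  · filter_upwards [hA.isClopen.compl.2.mem_nhds h] with v hv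
    have hv' : v ∉ A := hv
    simp [hv', h]

end IsCompactOpen

theorem fiber_union {G : Type*} [ArrowGroupoid G] (A B : Set G) (u : G) :
    fiber (A ∪ B) u = fiber A u ∪ fiber B u := by
  ext g; simp [fiber, or_and_right]

theorem fiber_mono {G : Type*} [ArrowGroupoid G] {A B : Set G} (h : A ⊆ B) (u : G) :
    fiber A u ⊆ fiber B u := fun _ hg => ⟨h hg.1, hg.2⟩

theorem fiber_subset {G : Type*} [ArrowGroupoid G] (A : Set G) (u : G) : fiber A u ⊆ A :=
  fun _ hg => hg.1

theorem subset_of_fiber_subset {G : Type*} [ArrowGroupoid G] {A B : Set G}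
    (h : ∀ u ∈ unitSpace G, fiber A u ⊆ B) : A ⊆ B :=
  fun g hg => h (src g) (src_mem g) ⟨hg, rfl⟩

section Etale

variable [IsEtale G]

theorem continuous_inv : Continuous (ArrowGroupoid.inv : G → G) := IsEtale.continuous_inv

theorem isLocalHomeomorph_rng : IsLocalHomeomorph (rng : G → G) := IsEtale.isLocalHomeomorph_rng

theorem continuous_rng : Continuous (rng : G → G) := isLocalHomeomorph_rng.continuous

theorem isOpenMap_rng : IsOpenMap (rng : G → G) := isLocalHomeomorph_rng.isOpenMap

theorem src_eq_rng_comp_inv : (src : G → G) = rng ∘ ArrowGroupoid.inv := by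
  ext g; simp [rng_inv]

theorem continuous_src : Continuous (src : G → G) := by
  rw [src_eq_rng_comp_inv]; exact continuous_rng.comp continuous_inv

theorem setInv_eq_image (A : Set G) : setInv A = ArrowGroupoid.inv '' A := by
  ext g
  exact ⟨fun h => ⟨g†, h, inv_inv g⟩, by rintro ⟨a, ha, rfl⟩; exact inv_mem_setInv ha⟩

theorem isOpen_setInv {A : Set G} (hA : IsOpen A) : IsOpen (setInv A) :=
  hA.preimage continuous_inv

theorem isOpenMap_src : IsOpenMap (src : G → G) := by
  rw [src_eq_rng_comp_inv]
  refine isOpenMap_rng.comp fun A hA => ?_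
  rw [← setInv_eq_image]
  exact isOpen_setInv hA

variable (G) in
theorem isOpen_unitSpace : IsOpen (unitSpace G) := isOpenMap_rng.isOpen_range

/-- Near `a ⋆ b`, the local section `e.symm` of `rng` through `a` factors each arrow `g` as `a' ⋆
(a'† ⋆ g)`. Both factors depend continuously on `g`, so they stay in `A` and `B`. -/
theorem isOpen_setMul {A B : Set G} (hA : IsOpen A) (hB : IsOpen B) : IsOpen (setMul A B) := by
  rw [isOpen_iff_mem_nhds]
  intro g hg
  obtain ⟨a, ha, b, hb, h, rfl⟩ := mem_setMul.1 hg
  obtain ⟨e, hae, he⟩ := isLocalHomeomorph_rng (G := G) a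
  have hra : rng (a ⋆ b) = rng a := rng_mul h
  have hesymm : e.symm (rng a) = a := by
    rw [he]; exact e.left_inv hae
  have hta : rng a ∈ e.target := by rw [he]; exact e.map_source hae
  have h1 : Filter.Tendsto (fun g : G => e.symm (rng g)) (𝓝 (a ⋆ b)) (𝓝 a) := by
    have hc : ContinuousAt e.symm (rng (a ⋆ b)) := by
      rw [hra]; exact e.continuousAt_symm hta
    have := hc.tendsto.comp (continuous_rng.tendsto (a ⋆ b))
    rwa [hra, hesymm] at this
  have h2 : ∀ᶠ g : G in 𝓝 (a ⋆ b), rng (e.symm (rng g)) = rng g := by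
    have : ∀ᶠ g : G in 𝓝 (a ⋆ b), rng g ∈ e.target :=
      continuous_rng.continuousAt.eventually_mem (by rw [hra]; exact e.open_target.mem_nhds hta)
    filter_upwards [this] with g hg
    have := e.right_inv hg
    rwa [← he] at this
  have h3 : Filter.Tendsto (fun g : G => ((e.symm (rng g))†, g)) (𝓝 (a ⋆ b))
      (𝓝[{p : G × G | ArrowGroupoid.Comp p.1 p.2}] (a†, a ⋆ b)) := by
    refine tendsto_nhdsWithin_iff.2 ⟨?_, ?_⟩
    · exact ((continuous_inv.tendsto a).comp h1).prodMk_nhds Filter.tendsto_id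
    · filter_upwards [h2] with g hg
      rw [comp_iff, src_inv, hg]
  have h4 := (IsEtale.continuousOn_mul (G := G) (a†, a ⋆ b)
    (show ArrowGroupoid.Comp _ _ by rw [comp_iff, src_inv, hra])).tendsto.comp h3
  simp only [inv_mul_cancel_left h] at h4
  filter_upwards [h1.eventually_mem (hA.mem_nhds ha), h2, h4.eventually_mem (hB.mem_nhds hb)]
    with g hg1 hg2 hg3
  have := mul_mem_setMul hg1 hg3
    (by simp only [Function.comp]; rw [rng_mul (by rw [src_inv, hg2]), rng_inv])
  simp only [Function.comp] at this
  rwa [mul_inv_cancel_left hg2] at this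

variable [T2Space G]

theorem isCompact_setMul {A B : Set G} (hA : IsCompact A) (hB : IsCompact B) :
    IsCompact (setMul A B) := by
  have hcl : IsClosed {p : G × G | ArrowGroupoid.Comp p.1 p.2} := by
    simp only [comp_iff]
    exact isClosed_eq (continuous_src.comp continuous_fst) (continuous_rng.comp continuous_snd)
  have : setMul A B = (fun p : G × G => p.1 ⋆ p.2) ''
      ((A ×ˢ B) ∩ {p : G × G | ArrowGroupoid.Comp p.1 p.2}) := by
    ext g
    constructor
    · rintro ⟨a, ha, b, hb, h, rfl⟩
      exact ⟨(a, b), ⟨⟨ha, hb⟩, h⟩, rfl⟩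
    · rintro ⟨⟨a, b⟩, ⟨⟨ha, hb⟩, h⟩, rfl⟩
      exact ⟨a, ha, b, hb, h, rfl⟩
  rw [this]
  exact ((hA.prod hB).inter_right hcl).image_of_continuousOn
    (IsEtale.continuousOn_mul.mono inter_subset_right)

namespace IsCompactOpen

variable {A B : Set G}

theorem setMul (hA : IsCompactOpen A) (hB : IsCompactOpen B) :
    IsCompactOpen (EtaleGpd.setMul A B) :=
  ⟨isCompact_setMul hA.1 hB.1, isOpen_setMul hA.2 hB.2⟩

theorem setInv (hA : IsCompactOpen A) : IsCompactOpen (EtaleGpd.setInv A) :=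
  ⟨by rw [setInv_eq_image]; exact hA.1.image continuous_inv, isOpen_setInv hA.2⟩

theorem image_src (hA : IsCompactOpen A) : IsCompactOpen (src '' A) :=
  ⟨hA.1.image continuous_src, isOpenMap_src _ hA.2⟩

theorem image_rng (hA : IsCompactOpen A) : IsCompactOpen (rng '' A) :=
  ⟨hA.1.image continuous_rng, isOpenMap_rng _ hA.2⟩

theorem inter_src (hA : IsCompactOpen A) (hB : IsCompactOpen B) :
    IsCompactOpen (A ∩ src ⁻¹' B) := hA.inter_isClopen (hB.isClopen.preimage continuous_src)

theorem inter_rng (hA : IsCompactOpen A) (hB : IsCompactOpen B) :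
    IsCompactOpen (A ∩ rng ⁻¹' B) := hA.inter_isClopen (hB.isClopen.preimage continuous_rng)

end IsCompactOpen

variable (G) in
theorem isCompactOpen_unitSpace [CompactSpace (unitSpace G)] : IsCompactOpen (unitSpace G) :=
  ⟨isCompact_iff_compactSpace.2 inferInstance, isOpen_unitSpace G⟩

theorem IsBisection.injOn_src {G : Type*} [TopologicalSpace G] [ArrowGroupoid G] {B : Set G}
    (h : IsBisection B) : InjOn src B := by
  obtain ⟨U, -, hB, hs, -⟩ := h
  intro a ha b hb hab
  exact congrArg Subtype.val (hs.injective (a₁ := ⟨a, hB ha⟩) (a₂ := ⟨b, hB hb⟩) hab)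

theorem IsBisection.injOn_rng {G : Type*} [TopologicalSpace G] [ArrowGroupoid G] {B : Set G}
    (h : IsBisection B) : InjOn rng B := by
  obtain ⟨U, -, hB, -, hs⟩ := h
  intro a ha b hb hab
  exact congrArg Subtype.val (hs.injective (a₁ := ⟨a, hB ha⟩) (a₂ := ⟨b, hB hb⟩) hab)

omit [T2Space G] in
theorem isBisection_of_injOn {B : Set G} (ho : IsOpen B) (hs : InjOn src B) (hr : InjOn rng B) :
    IsBisection B := by
  refine ⟨B, ho, subset_rfl, ?_, ?_⟩
  · exact .of_continuous_injective_isOpenMap (continuous_src.comp continuous_subtype_val)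
      (injOn_iff_injective.1 hs) (isOpenMap_src.comp ho.isOpenMap_subtype_val)
  · exact .of_continuous_injective_isOpenMap (continuous_rng.comp continuous_subtype_val)
      (injOn_iff_injective.1 hr) (isOpenMap_rng.comp ho.isOpenMap_subtype_val)

end Etale

section Ample

theorem IsAmple.exists_subset (hG : IsAmple G) {g : G} {Ω : Set G} (hΩ : IsOpen Ω) (hg : g ∈ Ω) :
    ∃ Q, IsCompactOpen Q ∧ InjOn src Q ∧ InjOn rng Q ∧ g ∈ Q ∧ Q ⊆ Ω := by
  obtain ⟨Q, ⟨hc, ho, hb⟩, hgQ, hQ⟩ := hG.exists_subset_of_mem_open hg hΩ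
  exact ⟨Q, ⟨hc, ho⟩, hb.injOn_src, hb.injOn_rng, hgQ, hQ⟩

theorem IsAmple.exists_between (hG : IsAmple G) {K Ω : Set G} (hK : IsCompact K) (hΩ : IsOpen Ω)
    (h : K ⊆ Ω) : ∃ Q, IsCompactOpen Q ∧ K ⊆ Q ∧ Q ⊆ Ω := by
  refine hK.induction_on (p := fun s => ∃ Q, IsCompactOpen Q ∧ s ⊆ Q ∧ Q ⊆ Ω)
    ⟨∅, .empty, subset_rfl, empty_subset _⟩ ?_ ?_ ?_
  · rintro s t hst ⟨Q, hQ, ht, hQΩ⟩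
    exact ⟨Q, hQ, hst.trans ht, hQΩ⟩
  · rintro s t ⟨Q, hQ, hs, hQΩ⟩ ⟨Q', hQ', ht, hQΩ'⟩
    exact ⟨Q ∪ Q', hQ.union hQ', union_subset_union hs ht, union_subset hQΩ hQΩ'⟩
  · intro x hx
    obtain ⟨Q, hQ, -, -, hxQ, hQΩ⟩ := hG.exists_subset hΩ (h hx)
    exact ⟨Q, mem_nhdsWithin_of_mem_nhds (hQ.2.mem_nhds hxQ), Q, hQ, subset_rfl, hQΩ⟩

variable [T2Space G]

/-- Compact open sets are built from compact open bisections by disjoint unions. -/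
theorem IsAmple.induction (hG : IsAmple G) {p : Set G → Prop} (h0 : p ∅)
    (h1 : ∀ B, IsCompactOpen B → InjOn src B → InjOn rng B → p B)
    (h2 : ∀ A B, IsCompactOpen A → IsCompactOpen B → Disjoint A B → p A → p B → p (A ∪ B))
    {Λ : Set G} (hΛ : IsCompactOpen Λ) : p Λ := by
  -- The property is made hereditary so that overlapping members of a finite cover can be cut into
  -- disjoint pieces.
  suffices ∃ A, IsCompactOpen A ∧ Λ ⊆ A ∧ ∀ A', IsCompactOpen A' → A' ⊆ A → p A' by
    obtain ⟨A, -, hA, h⟩ := this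
    exact h Λ hΛ hA
  refine hΛ.1.induction_on
    (p := fun s => ∃ A, IsCompactOpen A ∧ s ⊆ A ∧ ∀ A', IsCompactOpen A' → A' ⊆ A → p A')
    ⟨∅, .empty, subset_rfl, ?_⟩ ?_ ?_ ?_
  · intro A' _ h
    rwa [subset_empty_iff.1 h]
  · rintro s t hst ⟨A, hA, ht, h⟩
    exact ⟨A, hA, hst.trans ht, h⟩
  · rintro s t ⟨A, hA, hs, h⟩ ⟨B, hB, ht, h'⟩
    refine ⟨A ∪ B, hA.union hB, union_subset_union hs ht, fun A' hA' hsub => ?_⟩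
    rw [← inter_union_sdiff A' A]
    refine h2 _ _ (hA'.inter hA) (hA'.diff hA) (disjoint_sdiff_inter.symm)
      (h _ (hA'.inter hA) inter_subset_right) (h' _ (hA'.diff hA) ?_)
    exact fun x hx => (hsub hx.1).resolve_left hx.2
  · intro x _
    obtain ⟨Q, hQ, hs, hr, hxQ, -⟩ := hG.exists_subset isOpen_univ (mem_univ x)
    exact ⟨Q, mem_nhdsWithin_of_mem_nhds (hQ.2.mem_nhds hxQ), Q, hQ, subset_rfl,
      fun A' hA' h => h1 A' hA' (hs.mono h) (hr.mono h)⟩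

variable [IsEtale G]

/-- For a compact open bisection the fiber count is the indicator of its clopen source, and counts
add over disjoint unions. -/
theorem IsAmple.fiber_aux (hG : IsAmple G) {Λ : Set G} (hΛ : IsCompactOpen Λ) :
    (∀ u, (fiber Λ u).Finite) ∧ (∃ c, ∀ u, (fiber Λ u).ncard ≤ c) ∧
      ∀ u, ∀ᶠ v in 𝓝 u, (fiber Λ v).ncard = (fiber Λ u).ncard := by
  refine hG.induction (p := fun Λ => (∀ u, (fiber Λ u).Finite) ∧
    (∃ c, ∀ u, (fiber Λ u).ncard ≤ c) ∧
      ∀ u, ∀ᶠ v in 𝓝 u, (fiber Λ v).ncard = (fiber Λ u).ncard) ?_ ?_ ?_ hΛ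
  · simp [fiber]
  · intro B hB hs _
    have hcard : ∀ u, (fiber B u).Subsingleton := fun u a ha b hb =>
      hs ha.1 hb.1 (ha.2.trans hb.2.symm)
    have h01 : ∀ u, (fiber B u).ncard ≤ 1 := fun u =>
      haveI : Finite (fiber B u) := (hcard u).finite; ncard_le_one_iff_subsingleton.2 (hcard u)
    have hne : ∀ u, u ∈ src '' B ↔ (fiber B u).ncard = 1 := fun u => by
      constructor
      · rintro ⟨b, hb, rfl⟩
        exact le_antisymm (h01 _) (Nat.one_le_iff_ne_zero.2
          (((ncard_pos (hcard _).finite).2 ⟨b, hb, rfl⟩).ne'))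
      · intro h
        obtain ⟨b, hb⟩ := (ncard_pos (hcard u).finite).1 (by lia)
        exact ⟨b, hb.1, hb.2⟩
    refine ⟨fun u => (hcard u).finite, ⟨1, h01⟩, fun u => ?_⟩
    filter_upwards [hB.image_src.eventually_mem_iff u] with v hv
    rw [hne, hne] at hv
    have := h01 u
    have := h01 v
    lia
  · rintro A B - - hd ⟨hA1, ⟨c, hA2⟩, hA3⟩ ⟨hB1, ⟨c', hB2⟩, hB3⟩
    have hcard : ∀ u, (fiber (A ∪ B) u).ncard = (fiber A u).ncard + (fiber B u).ncard := fun u => by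
      rw [fiber_union, ncard_union_eq (hd.mono (fiber_subset _ _) (fiber_subset _ _)) (hA1 u) (hB1 u)]
    refine ⟨fun u => ?_, ⟨c + c', fun u => ?_⟩, fun u => ?_⟩
    · rw [fiber_union]; exact (hA1 u).union (hB1 u)
    · rw [hcard]; exact add_le_add (hA2 u) (hB2 u)
    · filter_upwards [hA3 u, hB3 u] with v hv hv'
      rw [hcard, hcard, hv, hv']

theorem IsAmple.finite_fiber (hG : IsAmple G) {Λ : Set G} (hΛ : IsCompactOpen Λ) (u : G) :
    (fiber Λ u).Finite := (hG.fiber_aux hΛ).1 u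

theorem IsAmple.exists_ncard_fiber_le (hG : IsAmple G) {Λ : Set G} (hΛ : IsCompactOpen Λ) :
    ∃ c, ∀ u, (fiber Λ u).ncard ≤ c := (hG.fiber_aux hΛ).2.1

theorem IsAmple.eventually_ncard_fiber (hG : IsAmple G) {Λ : Set G} (hΛ : IsCompactOpen Λ) (u : G) :
    ∀ᶠ v in 𝓝 u, (fiber Λ v).ncard = (fiber Λ u).ncard := (hG.fiber_aux hΛ).2.2 u

/-- The sources of the compact set `Λ \ Ω` form a closed set that avoids `u`. -/
theorem eventually_fiber_subset {Λ Ω : Set G} (hΛ : IsCompact Λ) (hΩ : IsOpen Ω) {u : G}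
    (h : fiber Λ u ⊆ Ω) : ∀ᶠ v in 𝓝 u, fiber Λ v ⊆ Ω := by
  have hcl : IsClosed (src '' (Λ \ Ω)) := ((hΛ.diff hΩ).image continuous_src).isClosed
  have hu : u ∈ (src '' (Λ \ Ω))ᶜ := by
    rintro ⟨g, ⟨hg, hg'⟩, rfl⟩
    exact hg' (h ⟨hg, rfl⟩)
  filter_upwards [hcl.isOpen_compl.mem_nhds hu] with v hv g hg
  by_contra hgΩ
  exact hv ⟨g, ⟨hg.1, hgΩ⟩, hg.2⟩

omit [T2Space G] [IsEtale G] in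
-- One compact open bisection is taken around each point. They may overlap, since only the fiber
-- over `u` has to be exact.
theorem IsAmple.exists_lift (hG : IsAmple G) {u : G} {F Ω : Set G} (hF : F.Finite)
    (hFu : ∀ x ∈ F, src x = u) (hΩ : IsOpen Ω) (h : F ⊆ Ω) :
    ∃ Q, IsCompactOpen Q ∧ Q ⊆ Ω ∧ fiber Q u = F := by
  induction F, hF using Set.Finite.induction_on with
  | empty => exact ⟨∅, .empty, empty_subset _, by simp [fiber]⟩
  | insert _ _ ih =>
    rename_i x F _ _
    obtain ⟨Q, hQ, hQΩ, hQF⟩ := ih (fun y hy => hFu y (mem_insert_of_mem x hy))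
      ((subset_insert x F).trans h)
    obtain ⟨B, hB, hs, -, hxB, hBΩ⟩ := hG.exists_subset hΩ (h (mem_insert x F))
    refine ⟨B ∪ Q, hB.union hQ, union_subset hBΩ hQΩ, ?_⟩
    have hx : src x = u := hFu x (mem_insert x F)
    rw [fiber_union, hQF, insert_eq]
    congr 1
    ext y
    constructor
    · rintro ⟨hy, hyu⟩
      exact hs hy hxB (hyu.trans hx.symm)
    · rintro rfl
      exact ⟨hxB, hx⟩

/-- Locally available families of fibers glue to a compact open set. -/
theorem IsAmple.exists_glue (hG : IsAmple G) {S : Set G} (hS : IsCompactOpen S)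
    (P : G → Set G → Prop)
    (h : ∀ u ∈ S, ∃ Q, IsCompactOpen Q ∧ ∀ᶠ v in 𝓝 u, v ∈ S → P v (fiber Q v)) :
    ∃ T, IsCompactOpen T ∧ src '' T ⊆ S ∧ ∀ v ∈ S, P v (fiber T v) := by
  suffices ∃ S', IsCompactOpen S' ∧ S' ⊆ S ∧ S ⊆ S' ∧ ∃ T, IsCompactOpen T ∧ src '' T ⊆ S' ∧
      ∀ v ∈ S', P v (fiber T v) by
    obtain ⟨S', -, h1, h2, h⟩ := this
    rwa [h1.antisymm h2] at h
  refine hS.1.induction_on (p := fun s => ∃ S', IsCompactOpen S' ∧ S' ⊆ S ∧ s ⊆ S' ∧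
    ∃ T, IsCompactOpen T ∧ src '' T ⊆ S' ∧ ∀ v ∈ S', P v (fiber T v))
    ⟨∅, .empty, empty_subset _, subset_rfl, ∅, .empty, by simp, by simp⟩ ?_ ?_ ?_
  · rintro s t hst ⟨S', hS', h1, h2, h3⟩
    exact ⟨S', hS', h1, hst.trans h2, h3⟩
  · rintro s t ⟨S₁, hS₁, h₁, hs, T₁, hT₁, hTS₁, hP₁⟩ ⟨S₂, hS₂, h₂, ht, T₂, hT₂, hTS₂, hP₂⟩
    -- On the overlap of the two base sets the first family takes priority, so each fiber comes from
    -- exactly one of them.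
    refine ⟨S₁ ∪ S₂, hS₁.union hS₂, union_subset h₁ h₂, union_subset_union hs ht,
      T₁ ∪ (T₂ ∩ src ⁻¹' (S₂ \ S₁)), hT₁.union (hT₂.inter_src (hS₂.diff hS₁)), ?_, ?_⟩
    · rintro _ ⟨g, hg | hg, rfl⟩
      exacts [Or.inl (hTS₁ ⟨g, hg, rfl⟩), Or.inr (hTS₂ ⟨g, hg.1, rfl⟩)]
    · intro v hv
      by_cases hv1 : v ∈ S₁
      · convert hP₁ v hv1 using 1
        rw [fiber_union, union_eq_left]
        rintro g ⟨⟨-, hg⟩, rfl⟩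
        exact absurd hv1 hg.2
      · convert hP₂ v (hv.resolve_left hv1) using 1
        rw [fiber_union]
        ext g
        constructor
        · rintro (⟨hg, rfl⟩ | ⟨⟨hg, -⟩, rfl⟩)
          exacts [absurd (hTS₁ ⟨g, hg, rfl⟩) hv1, ⟨hg, rfl⟩]
        · rintro ⟨hg, rfl⟩
          exact Or.inr ⟨⟨hg, hv.resolve_left hv1, hv1⟩, rfl⟩
  · intro u hu
    obtain ⟨Q, hQ, hP⟩ := h u hu
    obtain ⟨U, hU, hUo, huU⟩ := eventually_nhds_iff.1 hP
    obtain ⟨W, hW, -, -, huW, hWU⟩ := hG.exists_subset (hUo.inter hS.2) ⟨huU, hu⟩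
    refine ⟨W, mem_nhdsWithin_of_mem_nhds (hW.2.mem_nhds huW), W, hW,
      hWU.trans inter_subset_right, subset_rfl, Q ∩ src ⁻¹' W, hQ.inter_src hW, ?_, ?_⟩
    · rintro _ ⟨g, hg, rfl⟩
      exact hg.2
    · intro v hv
      convert hU v (hWU hv).1 (hWU hv).2 using 1
      ext g
      exact ⟨fun hg => ⟨hg.1.1, hg.2⟩, fun hg => ⟨⟨hg.1, by rw [mem_preimage, hg.2]; exact hv⟩, hg.2⟩⟩

/-- A compact open set contains a compact open set with prescribed numbers of points in
the fibers. -/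
theorem IsAmple.exists_ncard_fiber_eq [CompactSpace (unitSpace G)] (hG : IsAmple G) {P : Set G}
    (hP : IsCompactOpen P) (f : G → ℕ) (hf : ∀ u ∈ unitSpace G, ∀ᶠ v in 𝓝 u, f v = f u)
    (hle : ∀ u ∈ unitSpace G, f u ≤ (fiber P u).ncard) :
    ∃ P₀, IsCompactOpen P₀ ∧ P₀ ⊆ P ∧ ∀ u ∈ unitSpace G, (fiber P₀ u).ncard = f u := by
  obtain ⟨T, hT, -, h⟩ := hG.exists_glue (isCompactOpen_unitSpace G)
    (fun v A => A ⊆ P ∧ A.ncard = f v) (by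
      intro u hu
      obtain ⟨F, hF, hcard⟩ := exists_subset_card_eq (hle u hu)
      obtain ⟨Q, hQ, hQP, hQF⟩ := hG.exists_lift ((hG.finite_fiber hP u).subset hF)
        (fun x hx => (hF hx).2) hP.2 (hF.trans (fiber_subset _ _))
      refine ⟨Q, hQ, ?_⟩
      filter_upwards [hf u hu, hG.eventually_ncard_fiber hQ u] with v hv hv' _
      exact ⟨(fiber_subset _ _).trans hQP, by rw [hv', hQF, hcard, hv]⟩)
  exact ⟨T, hT, subset_of_fiber_subset fun u hu => (h u hu).1, fun u hu => (h u hu).2⟩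

end Ample

end TopologicalTools

/-! ### Cardinalities of products with a finite set -/

section Counting

theorem ncard_biUnion_eq_sum {ι α : Type*} (t : Finset ι) (f : ι → Set α)
    (hf : ∀ i ∈ t, (f i).Finite) (hd : ∀ i ∈ t, ∀ j ∈ t, i ≠ j → Disjoint (f i) (f j)) :
    (⋃ i ∈ t, f i).ncard = ∑ i ∈ t, (f i).ncard := by
  classical
  induction t using Finset.induction_on with
  | empty => simp
  | insert a t ha ih =>
    have hfin : (⋃ i ∈ t, f i).Finite :=
      t.finite_toSet.biUnion (t := f) fun i hi => hf i (Finset.mem_insert_of_mem hi)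
    rw [Finset.sum_insert ha, Finset.set_biUnion_insert,
      ncard_union_eq ?_ (hf a (Finset.mem_insert_self _ _)) hfin, ih]
    · exact fun i hi => hf i (Finset.mem_insert_of_mem hi)
    · exact fun i hi j hj => hd i (Finset.mem_insert_of_mem hi) j (Finset.mem_insert_of_mem hj)
    · simp only [disjoint_iUnion_right]
      intro j hj
      exact hd a (Finset.mem_insert_self _ _) j (Finset.mem_insert_of_mem hj)
        (by rintro rfl; exact ha hj)

variable {G : Type*} [ArrowGroupoid G]

theorem setMul_singleton (A : Set G) (x : G) :
    setMul A {x} = (fun a => a ⋆ x) '' fiber A (rng x) := by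
  ext g
  simp only [mem_setMul, mem_singleton_iff, exists_eq_left, mem_image, fiber]
  constructor
  · rintro ⟨a, ha, h, rfl⟩; exact ⟨a, ⟨ha, h⟩, rfl⟩
  · rintro ⟨a, ⟨ha, h⟩, rfl⟩; exact ⟨a, ha, h, rfl⟩

theorem ncard_setMul_singleton (A : Set G) (x : G) :
    (setMul A {x}).ncard = (fiber A (rng x)).ncard := by
  rw [setMul_singleton, InjOn.ncard_image]
  intro a ha b hb h
  exact mul_right_cancel ha.2 hb.2 h

theorem setMul_eq_biUnion (A F : Set G) : setMul A F = ⋃ x ∈ F, setMul A {x} := by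
  ext g
  simp only [mem_setMul, mem_iUnion, mem_singleton_iff, exists_eq_left]
  constructor
  · rintro ⟨a, ha, x, hx, h⟩; exact ⟨x, hx, a, ha, h⟩
  · rintro ⟨x, hx, a, ha, h⟩; exact ⟨a, ha, x, hx, h⟩

theorem unitSpace_setMul (F : Set G) : setMul (unitSpace G) F = F := by
  refine subset_antisymm ?_ (subset_setMul subset_rfl F)
  intro g hg
  obtain ⟨a, ha, x, hx, h, rfl⟩ := mem_setMul.1 hg
  rw [src_unit ha] at h
  rwa [h, rng_mul_self]

theorem finite_setMul {A F : Set G} (hA : ∀ u, (fiber A u).Finite) (hF : F.Finite) :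
    (setMul A F).Finite := by
  rw [setMul_eq_biUnion]
  refine hF.biUnion fun x _ => ?_
  rw [setMul_singleton]
  exact (hA _).image _

theorem fiber_unitSpace {u : G} (hu : u ∈ unitSpace G) : fiber (unitSpace G) u = {u} := by
  ext g
  constructor
  · rintro ⟨hg, rfl⟩
    exact (src_unit hg).symm
  · rintro rfl
    exact ⟨hu, src_unit hu⟩

theorem ncard_fiber_unitSpace {u : G} (hu : u ∈ unitSpace G) :
    (fiber (unitSpace G) u).ncard = 1 := by
  rw [fiber_unitSpace hu, ncard_singleton]

/-- The range of a product determines its factor in `B`, and cancelling that factor determines the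
other one. -/
theorem disjoint_translates {B : Set G} (hB : InjOn rng B) {x y : G} (h : x ≠ y) :
    Disjoint (setMul B {x}) (setMul B {y}) := by
  rw [Set.disjoint_left]
  intro g hg hg'
  obtain ⟨a, ha, x', rfl, hx, rfl⟩ := mem_setMul.1 hg
  obtain ⟨b, hb, y', rfl, hy, hab⟩ := mem_setMul.1 hg'
  have hr : b = a := hB hb ha (by rw [← rng_mul hy, hab, rng_mul hx])
  subst hr
  exact h (mul_left_cancel hx hy hab.symm)

/-- Comparison of the cardinalities of two products, when the translates of `B` are disjoint. -/
theorem ncard_setMul_le {A B F : Set G} {c : ℝ} (hF : F.Finite)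
    (hB : ∀ u, (fiber B u).Finite)
    (hd : ∀ x ∈ F, ∀ y ∈ F, x ≠ y → Disjoint (setMul B {x}) (setMul B {y}))
    (h : ∀ x ∈ F, ((fiber A (rng x)).ncard : ℝ) ≤ c * (fiber B (rng x)).ncard) :
    ((setMul A F).ncard : ℝ) ≤ c * (setMul B F).ncard := by
  lift F to Finset G using hF
  rw [setMul_eq_biUnion A, setMul_eq_biUnion B]
  simp only [Finset.mem_coe] at *
  rw [ncard_biUnion_eq_sum F _ (fun x _ => finite_setMul hB (finite_singleton x)) hd]
  calc (((⋃ x ∈ F, setMul A {x}).ncard : ℕ) : ℝ)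
      ≤ ((∑ x ∈ F, (setMul A {x}).ncard : ℕ) : ℝ) := by
        exact_mod_cast F.set_ncard_biUnion_le _
    _ ≤ c * ((∑ x ∈ F, (setMul B {x}).ncard : ℕ) : ℝ) := by
        push_cast
        rw [Finset.mul_sum]
        refine Finset.sum_le_sum fun x hx => ?_
        rw [ncard_setMul_singleton, ncard_setMul_singleton]
        exact h x hx

theorem injOn_rng_unitSpace : InjOn rng (unitSpace G) := fun a ha b hb h => by
  rwa [rng_unit ha, rng_unit hb] at h

theorem finite_fiber_unitSpace (u : G) : (fiber (unitSpace G) u).Finite := by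
  refine (finite_singleton u).subset ?_
  rintro g ⟨hg, rfl⟩
  exact (src_unit hg).symm

theorem ncard_setMul_le_mul {A F : Set G} {c : ℝ} (hF : F.Finite)
    (h : ∀ x ∈ F, ((fiber A (rng x)).ncard : ℝ) ≤ c) :
    ((setMul A F).ncard : ℝ) ≤ c * F.ncard := by
  have := ncard_setMul_le (B := unitSpace G) hF finite_fiber_unitSpace
    (fun x _ y _ hxy => disjoint_translates injOn_rng_unitSpace hxy) (A := A)
    (fun x hx => by simpa [ncard_fiber_unitSpace (rng_mem x)] using h x hx)
  rwa [unitSpace_setMul] at this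

theorem mul_ncard_le {J F : Set G} {N : ℝ} (hN : 0 < N) (hF : F.Finite)
    (hJ : ∀ u, (fiber J u).Finite)
    (hd : ∀ x ∈ F, ∀ y ∈ F, x ≠ y → Disjoint (setMul J {x}) (setMul J {y}))
    (h : ∀ x ∈ F, N ≤ (fiber J (rng x)).ncard) :
    N * F.ncard ≤ (setMul J F).ncard := by
  have := ncard_setMul_le (A := unitSpace G) (c := N⁻¹) hF hJ hd
    (fun x hx => by
      rw [ncard_fiber_unitSpace (rng_mem x), Nat.cast_one, ← div_eq_inv_mul, le_div_iff₀ hN, one_mul]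
      exact h x hx)
  rwa [unitSpace_setMul, ← div_eq_inv_mul, le_div_iff₀ hN, mul_comm] at this

end Counting

/-! ### Uniform Følner sets -/

section Folner

set_option linter.unusedSectionVars false

variable {G : Type*} [TopologicalSpace G] [ArrowGroupoid G] [T2Space G] [IsEtale G]
  [CompactSpace (unitSpace G)]

/-- The units from which no arrow leads into `W` form a closed invariant set that omits `w`, so by
minimality it is empty. -/
theorem IsMinimal.exists_arrow (hmin : IsMinimal G) {W : Set G} (hW : IsOpen W) {w : G}
    (hw : w ∈ W) (hwu : w ∈ unitSpace G) {v : G} (hv : v ∈ unitSpace G) :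
    ∃ g, src g = v ∧ rng g ∈ W := by
  have hD := hmin (unitSpace G \ src '' (rng ⁻¹' W)) sdiff_subset
    ((isCompactOpen_unitSpace G).isClopen.1.sdiff (isOpenMap_src _ (hW.preimage continuous_rng))) (by
      ext d
      constructor
      · rintro ⟨_, hx, rfl⟩
        obtain ⟨g, -, d, hd, h, rfl⟩ := mem_setMul.1 hx
        rw [rng_mul h]
        refine ⟨rng_mem g, ?_⟩
        rintro ⟨k, hk, hkg⟩
        refine hd.2 ⟨k ⋆ g, ?_, ?_⟩
        · rw [mem_preimage, rng_mul hkg]; exact hk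
        · rw [src_mul hkg, h, rng_unit hd.1]
      · intro hd
        refine ⟨d, ?_, rng_unit hd.1⟩
        have := mul_mem_setMul (mem_univ d) hd (by rw [src_unit hd.1, rng_unit hd.1])
        nth_rewrite 1 [← rng_unit hd.1] at this
        rwa [rng_mul_self] at this)
  rcases hD with hD | hD
  · by_contra hcon
    have : v ∈ unitSpace G \ src '' (rng ⁻¹' W) := by
      refine ⟨hv, ?_⟩
      rintro ⟨g, hg, rfl⟩
      exact hcon ⟨g, rfl, hg⟩
    rw [hD] at this
    exact this
  · have : w ∈ unitSpace G \ src '' (rng ⁻¹' W) := by rw [hD]; exact hwu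
    exact absurd ⟨w, by rw [mem_preimage, rng_unit hwu]; exact hw, src_unit hwu⟩ this.2

/-- Fiberwise amenability provides a Følner set inside a single fiber. -/
theorem IsFiberwiseAmenable.exists_fiber (hfa : IsFiberwiseAmenable G) {K : Set G}
    (hK : IsCompact K) (hKf : ∀ u, (fiber K u).Finite) {ε : ℝ} (hε : 0 < ε) :
    ∃ u ∈ unitSpace G, ∃ F : Set G, F.Finite ∧ F.Nonempty ∧ (∀ x ∈ F, src x = u) ∧
      ((setMul K F).ncard : ℝ) ≤ (1 + ε) * F.ncard := by
  classical
  obtain ⟨F, hF, hne, hbf, hb⟩ := hfa K hK ε hε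
  have hpos : (0 : ℝ) < F.ncard := by exact_mod_cast (ncard_pos hF).2 hne
  have hKF : ((setMul K F).ncard : ℝ) ≤ (1 + ε) * F.ncard := by
    have h1 : (setMul K F).ncard ≤ (boundary K F).ncard + F.ncard := by
      refine (ncard_le_ncard (t := boundary K F ∪ F) ?_ (hbf.union hF)).trans (ncard_union_le _ _)
      intro x hx
      by_cases hxF : x ∈ F
      exacts [Or.inr hxF, Or.inl (Or.inl ⟨hx, hxF⟩)]
    rw [div_le_iff₀ hpos] at hb
    have h2 : ((setMul K F).ncard : ℝ) ≤ (boundary K F).ncard + F.ncard := by exact_mod_cast h1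
    linarith
  set t : Finset G := (hF.image src).toFinset with ht
  have hcov : ∀ A : Set G, src '' A ⊆ src '' F → A = ⋃ u ∈ t, fiber A u := by
    intro A hA
    ext x
    simp only [mem_iUnion]
    constructor
    · intro hx
      exact ⟨src x, by rw [ht, Set.Finite.mem_toFinset]; exact hA ⟨x, hx, rfl⟩, hx, rfl⟩
    · rintro ⟨u, -, hx, -⟩
      exact hx
  have hdis : ∀ A : Set G, ∀ u ∈ t, ∀ v ∈ t, u ≠ v → Disjoint (fiber A u) (fiber A v) := by
    intro A u _ v _ huv
    rw [Set.disjoint_left]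
    rintro x ⟨-, rfl⟩ ⟨-, hx⟩
    exact huv hx
  have hsum : ∀ A : Set G, A.Finite → src '' A ⊆ src '' F →
      (A.ncard : ℝ) = ∑ u ∈ t, ((fiber A u).ncard : ℝ) := by
    intro A hAf hA
    have := ncard_biUnion_eq_sum t (fiber A) (fun u _ => hAf.subset (fiber_subset _ _)) (hdis A)
    rw [← hcov A hA] at this
    exact_mod_cast this
  -- If every fiber of `F` violated the estimate, summing over the finitely many sources would
  -- contradict the estimate for `F`.
  by_contra! hcon
  have hlt : ∀ u ∈ t, (1 + ε) * ((fiber F u).ncard : ℝ) < (fiber (setMul K F) u).ncard := by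
    intro u hu
    rw [ht, Set.Finite.mem_toFinset] at hu
    obtain ⟨x, hx, rfl⟩ := hu
    rw [fiber_setMul]
    exact hcon (src x) (src_mem x) _ (hF.subset (fiber_subset _ _)) ⟨x, hx, rfl⟩ (fun y hy => hy.2)
  have htne : t.Nonempty := by
    rw [ht, Set.Finite.toFinset_nonempty]; exact hne.image src
  have := Finset.sum_lt_sum_of_nonempty htne hlt
  rw [← Finset.mul_sum, ← hsum F hF subset_rfl, ← hsum _ (finite_setMul hKf hF) ?_] at this
  · linarith
  · rintro _ ⟨_, hx, rfl⟩
    obtain ⟨a, -, b, hb, h, rfl⟩ := mem_setMul.1 hx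
    exact ⟨b, hb, (src_mul h).symm⟩

/-- By minimality Følner sets can be found in all fibers, uniformly. -/
theorem exists_uniform_folner (hG : IsAmple G) (hmin : IsMinimal G) (hfa : IsFiberwiseAmenable G)
    {K : Set G} (hK : IsCompactOpen K) {ε : ℝ} (hε : 0 < ε) :
    ∃ L, IsCompactOpen L ∧ ∀ v ∈ unitSpace G, (fiber L v).Nonempty ∧
      ((fiber (setMul K L) v).ncard : ℝ) ≤ (1 + ε) * (fiber L v).ncard := by
  have hcount : ∀ {F : Set G} {u : G}, F.Finite → F.Nonempty → (∀ x ∈ F, src x = u) →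
      ((setMul K F).ncard : ℝ) ≤ (1 + ε) * F.ncard →
      ∃ Q, IsCompactOpen Q ∧ ∀ᶠ v in 𝓝 u, (fiber Q v).Nonempty ∧
        ((fiber (setMul K Q) v).ncard : ℝ) ≤ (1 + ε) * (fiber Q v).ncard := by
    intro F u hF hne hFu h
    obtain ⟨Q, hQ, -, hQF⟩ := hG.exists_lift hF hFu isOpen_univ (subset_univ _)
    refine ⟨Q, hQ, ?_⟩
    filter_upwards [hG.eventually_ncard_fiber hQ u, hG.eventually_ncard_fiber (hK.setMul hQ) u]
      with v h1 h2
    rw [hQF] at h1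
    rw [fiber_setMul K Q u, hQF] at h2
    refine ⟨?_, by rw [h1, h2]; exact h⟩
    rw [← ncard_pos (hG.finite_fiber hQ v), h1]
    exact (ncard_pos hF).2 hne
  obtain ⟨u, hu, F, hF, hne, hFu, hFK⟩ := hfa.exists_fiber hK.1 (hG.finite_fiber hK) hε
  obtain ⟨Q, hQ, hev⟩ := hcount hF hne hFu hFK
  obtain ⟨W, hW, hWo, huW⟩ := eventually_nhds_iff.1 hev
  obtain ⟨L, hL, -, h⟩ := hG.exists_glue (isCompactOpen_unitSpace G)
    (fun v A => A.Nonempty ∧ ((setMul K A).ncard : ℝ) ≤ (1 + ε) * A.ncard) (by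
      intro v hv
      -- Right translation by an arrow from `v` into `W` carries a Følner fiber to the fiber over
      -- `v`, because right translation commutes with left multiplication by `K` and preserves
      -- cardinalities.
      obtain ⟨g, rfl, hg⟩ := hmin.exists_arrow hWo huW hu hv
      obtain ⟨hne', hle⟩ := hW _ hg
      obtain ⟨Q', hQ', hev'⟩ := hcount (F := setMul Q {g}) (u := src g)
        (finite_setMul (hG.finite_fiber hQ) (finite_singleton g))
        (by rw [setMul_singleton]; exact hne'.image _)
        (by
          intro x hx
          obtain ⟨a, -, b, rfl, h, rfl⟩ := mem_setMul.1 hx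
          exact src_mul h)
        (by rw [← setMul_assoc, ncard_setMul_singleton, ncard_setMul_singleton]; exact hle)
      refine ⟨Q', hQ', ?_⟩
      filter_upwards [hev'] with w hw _
      rwa [fiber_setMul] at hw)
  refine ⟨L, hL, fun v hv => ?_⟩
  rw [fiber_setMul]
  exact h v hv

/-- The powers `K ^ n` of a set. -/
def setPow {G : Type*} [ArrowGroupoid G] (K : Set G) : ℕ → Set G
  | 0 => unitSpace G
  | n + 1 => setMul K (setPow K n)

theorem setPow_mono {G : Type*} [ArrowGroupoid G] {K : Set G} (hK : unitSpace G ⊆ K) :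
    Monotone (setPow K) := monotone_nat_of_le_succ fun _ => subset_setMul hK _

theorem IsCompactOpen.setPow {K : Set G} (hK : IsCompactOpen K) (n : ℕ) :
    IsCompactOpen (setPow K n) := by
  induction n with
  | zero => exact isCompactOpen_unitSpace G
  | succ n ih => exact hK.setMul ih

theorem exists_maximal_disjoint {α β : Type*} {N : Set α} (hN : N.Finite) (f : α → Set β) :
    ∃ Z ⊆ N, Z.PairwiseDisjoint f ∧ ∀ x ∈ N, (f x).Nonempty → ∃ z ∈ Z, ¬ Disjoint (f x) (f z) := by
  obtain ⟨Z, hZ, hmax⟩ := (hN.finite_subsets.subset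
    (sep_subset {Z | Z ⊆ N} fun Z => Z.PairwiseDisjoint f)).exists_maximal
    ⟨∅, empty_subset _, pairwiseDisjoint_empty⟩
  refine ⟨Z, hZ.1, hZ.2, fun x hx hne => ?_⟩
  by_contra! hcon
  have hxZ : x ∉ Z := fun h => by
    have := hcon x h
    rw [disjoint_self] at this
    exact hne.ne_empty this
  have hins : insert x Z ⊆ Z := hmax (y := insert x Z) ⟨insert_subset hx hZ.1,
    hZ.2.insert fun z hz _ => hcon z hz⟩ (subset_insert _ _)
  exact hxZ (hins (mem_insert _ _))

/-- Every finite set lies in a Følner set within a uniformly bounded distance. -/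
theorem exists_folner_superset (hG : IsAmple G) (hmin : IsMinimal G) (hfa : IsFiberwiseAmenable G)
    {K : Set G} (hK : IsCompactOpen K) (hKu : unitSpace G ⊆ K) {ε : ℝ} (hε : 0 < ε) :
    ∃ L, IsCompactOpen L ∧ ∀ M : Set G, M.Finite → ∃ F : Set G, F.Finite ∧ M ⊆ F ∧
      F ⊆ setMul L M ∧ ((setMul K F).ncard : ℝ) ≤ (1 + ε) * F.ncard := by
  obtain ⟨L, hL, hLF⟩ := exists_uniform_folner hG hmin hfa hK (half_pos hε)
  obtain ⟨c, hc⟩ := hG.exists_ncard_fiber_le hK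
  obtain ⟨d, hd⟩ := hG.exists_ncard_fiber_le (hL.setInv.setMul hL)
  -- One half of `ε` pays for the boundary of the packing, the other for `K M`, of size at most `c
  -- |M|`. After `R` steps of growth by `1 + ε`, the set `M` is negligible even after division by
  -- the packing constant `d + 1`; the `+ 1` keeps this constant positive.
  obtain ⟨R, hR⟩ := pow_unbounded_of_one_lt (2 * c * (d + 1) / ε) (show 1 < 1 + ε by linarith)
  refine ⟨setPow K R ∪ setMul L (setPow K R), (hK.setPow R).union (hL.setMul (hK.setPow R)),
    fun M hM => ?_⟩
  have hfin : ∀ r, (setMul (setPow K r) M).Finite := fun r =>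
    finite_setMul (hG.finite_fiber (hK.setPow r)) hM
  have hsub : ∀ r, M ⊆ setMul (setPow K r) M := fun r =>
    subset_setMul (setPow_mono hKu (Nat.zero_le r)) M
  by_cases hcase : ∃ r ≤ R, ((setMul K (setMul (setPow K r) M)).ncard : ℝ) ≤
      (1 + ε) * (setMul (setPow K r) M).ncard
  · obtain ⟨r, hr, h⟩ := hcase
    exact ⟨_, hfin r, hsub r, setMul_mono ((setPow_mono hKu hr).trans subset_union_left) subset_rfl,
      h⟩
  push Not at hcase
  have hgrow : ∀ r ≤ R, (1 + ε) ^ r * M.ncard ≤ (setMul (setPow K r) M).ncard := by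
    intro r
    induction r with
    | zero => intro _; simp [setPow, unitSpace_setMul]
    | succ r ih =>
      intro hr
      have h1 := ih (by lia)
      have h2 := hcase r (by lia)
      rw [← setMul_assoc] at h2
      change (1 + ε) ^ (r + 1) * M.ncard ≤ ((setMul (setMul K (setPow K r)) M).ncard : ℝ)
      rw [pow_succ']
      nlinarith
  set N := setMul (setPow K R) M with hN
  obtain ⟨Z, hZN, hZd, hZmax⟩ := exists_maximal_disjoint (hfin R) (fun x => setMul L {x})
  have hZ : Z.Finite := (hfin R).subset hZN
  have hLf := hG.finite_fiber hL
  have hdis : ∀ x ∈ Z, ∀ y ∈ Z, x ≠ y → Disjoint (setMul L {x}) (setMul L {y}) :=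
    fun x hx y hy hxy => hZd hx hy hxy
  -- By maximality each translate `L x` meets some `L z` with `z ∈ Z`, so the packing has at least
  -- `|N| / (d + 1)` members.
  have hNZ : N ⊆ setMul (setMul (setInv L) L) Z := by
    intro x hx
    obtain ⟨z, hz, hxz⟩ := hZmax x hx (by
      rw [setMul_singleton]; exact (hLF _ (rng_mem x)).1.image _)
    obtain ⟨g, hg, hg'⟩ := not_disjoint_iff.1 hxz
    obtain ⟨a, ha, x', rfl, hax, rfl⟩ := mem_setMul.1 hg
    obtain ⟨b, hb, z', rfl, hbz, hab⟩ := mem_setMul.1 hg'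
    rw [setMul_assoc, ← inv_mul_cancel_left hax, ← hab]
    refine mul_mem_setMul (inv_mem_setInv ha) (mul_mem_setMul hb hz hbz) ?_
    rw [hab, src_inv, rng_mul hax]
  have h1 : (N.ncard : ℝ) ≤ (d + 1) * Z.ncard := by
    refine le_trans ?_ (ncard_setMul_le_mul (A := setMul (setInv L) L) hZ
      fun x _ => ?_)
    · exact_mod_cast ncard_le_ncard hNZ
        (finite_setMul (hG.finite_fiber (hL.setInv.setMul hL)) hZ)
    · exact_mod_cast (hd _).trans (Nat.le_succ d)
  have h2 : (Z.ncard : ℝ) ≤ (setMul L Z).ncard := by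
    have := mul_ncard_le (J := L) one_pos hZ hLf hdis fun x _ => by
      exact_mod_cast (ncard_pos (hLf _)).2 (hLF _ (rng_mem x)).1
    linarith
  have h3 : ((setMul (setMul K L) Z).ncard : ℝ) ≤ (1 + ε / 2) * (setMul L Z).ncard :=
    ncard_setMul_le hZ hLf hdis fun x _ => (hLF _ (rng_mem x)).2
  have h4 : ((setMul K M).ncard : ℝ) ≤ c * M.ncard :=
    ncard_setMul_le_mul hM fun x _ => by exact_mod_cast hc _
  have hLZ : (setMul L Z).Finite := finite_setMul hLf hZ
  refine ⟨M ∪ setMul L Z, hM.union hLZ, subset_union_left, ?_, ?_⟩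
  · rw [setMul_union_left]
    refine union_subset_union (hsub R) ?_
    rw [setMul_assoc]
    exact setMul_mono subset_rfl hZN
  · rw [setMul_union_right, ← setMul_assoc]
    have h5 : (((setMul K M ∪ setMul (setMul K L) Z).ncard : ℕ) : ℝ) ≤
        (setMul K M).ncard + (setMul (setMul K L) Z).ncard := by
      exact_mod_cast ncard_union_le _ _
    have h6 : ((setMul L Z).ncard : ℝ) ≤ (M ∪ setMul L Z).ncard := by
      exact_mod_cast ncard_le_ncard subset_union_right (hM.union hLZ)
    have h7 := hgrow R le_rfl
    have h8 : 2 * c * (d + 1) / ε * M.ncard ≤ (d + 1) * (setMul L Z).ncard := by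
      calc 2 * c * (d + 1) / ε * M.ncard ≤ (1 + ε) ^ R * M.ncard := by gcongr
        _ ≤ (d + 1) * Z.ncard := h7.trans h1
        _ ≤ _ := by gcongr
    have h9 : c * M.ncard ≤ ε / 2 * (setMul L Z).ncard := by
      have hd1 : (0 : ℝ) < d + 1 := by positivity
      rw [div_mul_eq_mul_div, div_le_iff₀ hε] at h8
      have : (d + 1 : ℝ) * (c * M.ncard) ≤ (d + 1) * (ε / 2 * (setMul L Z).ncard) := by
        nlinarith
      exact le_of_mul_le_mul_left this hd1
    nlinarith

end Folner

/-! ### Castles as sets of columns -/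

section Castles

set_option linter.unusedSectionVars false

namespace IsMultisection

variable {G : Type*} [TopologicalSpace G] [ArrowGroupoid G] {F : Finset ℕ} {C : ℕ → ℕ → Set G}

theorem rng_mem (h : IsMultisection F C) {i j : ℕ} (hi : i ∈ F) (hj : j ∈ F) {g : G}
    (hg : g ∈ C i j) : rng g ∈ C i i := by
  rw [← h.mul_eq i hi i hi j hj] at hg
  obtain ⟨a, ha, b, -, hab, rfl⟩ := mem_setMul.1 hg
  rwa [rng_mul hab, rng_unit (h.level_subset i hi ha)]

theorem src_mem (h : IsMultisection F C) {i j : ℕ} (hi : i ∈ F) (hj : j ∈ F) {g : G}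
    (hg : g ∈ C i j) : src g ∈ C j j := by
  rw [← h.mul_eq i hi j hj j hj] at hg
  obtain ⟨a, -, b, hb, hab, rfl⟩ := mem_setMul.1 hg
  rwa [src_mul hab, src_unit (h.level_subset j hj hb)]

theorem exists_rng_eq (h : IsMultisection F C) {i j : ℕ} (hi : i ∈ F) (hj : j ∈ F) {x : G}
    (hx : x ∈ C i i) : ∃ g ∈ C i j, rng g = x := by
  have hxu := rng_unit (h.level_subset i hi hx)
  rw [← h.mul_eq i hi j hj i hi] at hx
  obtain ⟨a, ha, b, -, hab, rfl⟩ := mem_setMul.1 hx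
  exact ⟨a, ha, by rw [← rng_mul hab, hxu]⟩

end IsMultisection

variable {G : Type*} [TopologicalSpace G] [ArrowGroupoid G]

/-- Almost elementariness in terms of the columns of the castles. -/
theorem IsAlmostElementary.exists_columns [IsEtale G] (hae : IsAlmostElementary G) {K O : Set G}
    (hK : IsCompact K) (hKu : unitSpace G ⊆ K) (hO : IsOpen O) (hOu : O ⊆ unitSpace G)
    (hne : O.Nonempty) :
    ∃ TC TD : Set G, IsOpen TC ∧ IsOpen TD ∧ TC ⊆ TD ∧ InjOn rng TD ∧ setMul K TC ⊆ TD ∧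
      Subordinate (unitSpace G \ rng '' TC) O := by
  classical
  obtain ⟨m, F, E, C, D, hC, hD, hext, -, hsub⟩ := hae K hK hKu O hO hOu hne {unitSpace G}
    (by rintro _ rfl; exact ⟨isOpen_unitSpace G, subset_rfl⟩) (by simp)
  have hb : ∀ l, ∃ b, (F l).Nonempty → b ∈ F l := fun l => by
    by_cases h : (F l).Nonempty
    exacts [⟨h.choose, fun _ => h.choose_spec⟩, ⟨0, fun h' => absurd h' h⟩]
  choose b hb using hb
  have hbE : ∀ l, (F l).Nonempty → b l ∈ E l := fun l h => (hext l).1 (hb l h)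
  have hCD : ∀ l, ∀ i ∈ F l, ∀ j ∈ F l, C l i j = D l i j := fun l => (hext l).2.1
  refine ⟨⋃ l, ⋃ i ∈ F l, C l i (b l), ⋃ l, ⋃ (_ : (F l).Nonempty), ⋃ i ∈ E l, D l i (b l),
    ?_, ?_, ?_, ?_, ?_, ?_⟩
  · exact isOpen_iUnion fun l => isOpen_iUnion fun i => isOpen_iUnion fun hi =>
      hC.isOpen l i hi _ (hb l ⟨i, hi⟩)
  · exact isOpen_iUnion fun l => isOpen_iUnion fun h => isOpen_iUnion fun i => isOpen_iUnion
      fun hi => hD.isOpen l i hi _ (hbE l h)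
  · intro g hg
    simp only [mem_iUnion, exists_prop] at hg ⊢
    obtain ⟨l, i, hi, hg⟩ := hg
    exact ⟨l, ⟨i, hi⟩, i, (hext l).1 hi, by rwa [← hCD l i hi _ (hb l ⟨i, hi⟩)]⟩
  · intro g hg g' hg' hgg'
    simp only [mem_iUnion, exists_prop] at hg hg'
    obtain ⟨l, hl, i, hi, hg⟩ := hg
    obtain ⟨l', hl', i', hi', hg'⟩ := hg'
    have h1 := (hD.multisection l).rng_mem hi (hbE l hl) hg
    have h2 := (hD.multisection l').rng_mem hi' (hbE l' hl') hg'
    rw [← hgg'] at h2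
    obtain rfl : l = l' := by
      by_contra hne
      have := mul_mem_setMul h1 h2 (by rw [src_rng, rng_rng])
      rw [hD.disjoint l l' hne i hi i hi i' hi' i' hi'] at this
      exact this
    obtain rfl : i = i' := by
      by_contra hne
      exact Set.disjoint_left.1 ((hD.multisection l).level_disjoint i hi i' hi' hne) h1 h2
    exact ((hD.multisection l).bisection i hi _ (hbE l hl)).injOn_rng hg hg' hgg'
  · intro g hg
    obtain ⟨k, hk, c, hc, hkc, rfl⟩ := mem_setMul.1 hg
    simp only [mem_iUnion, exists_prop] at hc ⊢
    obtain ⟨l, i, hi, hc⟩ := hc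
    have hbl := hb l ⟨i, hi⟩
    -- Extendability only places `k ⋆ c` in some `D l i' j`. Its source lies in the base level, and
    -- disjointness of the levels forces `j = b l`.
    have h1 : k ⋆ c ∈ multisectionUnion (E l) (D l) := by
      refine (hext l).2.2 (mul_mem_setMul hk ?_ hkc)
      simp only [multisectionUnion, mem_iUnion, exists_prop]
      exact ⟨i, hi, _, hbl, hc⟩
    simp only [multisectionUnion, mem_iUnion, exists_prop] at h1
    obtain ⟨i', hi', j, hj, h1⟩ := h1
    have h2 := (hD.multisection l).src_mem hi' hj h1
    have h3 := (hC.multisection l).src_mem hi hbl hc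
    rw [hCD l _ hbl _ hbl] at h3
    rw [src_mul hkc] at h2
    obtain rfl : j = b l := by
      by_contra hne
      exact Set.disjoint_left.1 ((hD.multisection l).level_disjoint j hj _ (hbE l ⟨i, hi⟩) hne) h2 h3
    exact ⟨l, ⟨i, hi⟩, i', hi', h1⟩
  · convert hsub using 2
    ext x
    simp only [levelUnion, mem_image, mem_iUnion, exists_prop]
    constructor
    · rintro ⟨g, ⟨l, i, hi, hg⟩, rfl⟩
      exact ⟨l, i, hi, (hC.multisection l).rng_mem hi (hb l ⟨i, hi⟩) hg⟩
    · rintro ⟨l, i, hi, hx⟩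
      obtain ⟨g, hg, rfl⟩ := (hC.multisection l).exists_rng_eq hi (hb l ⟨i, hi⟩) hx
      exact ⟨g, ⟨l, i, hi, hg⟩, rfl⟩

/-- `R` is equivalent, through a compact open set of arrows, to a subset of `O`. -/
def Embeds (R O : Set G) : Prop :=
  ∃ A : Set G, IsCompactOpen A ∧ InjOn src A ∧ InjOn rng A ∧ src '' A = R ∧ rng '' A ⊆ O

variable [T2Space G] [IsEtale G]

theorem Embeds.mono {R R' O : Set G} (h : Embeds R O) (hR' : IsCompactOpen R') (hsub : R' ⊆ R) :
    Embeds R' O := by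
  obtain ⟨A, hA, hs, hr, rfl, hO⟩ := h
  refine ⟨A ∩ src ⁻¹' R', hA.inter_src hR', hs.mono inter_subset_left, hr.mono inter_subset_left,
    ?_, (image_mono inter_subset_left).trans hO⟩
  rw [image_inter_preimage, inter_eq_right.2 hsub]

theorem Embeds.union {R R' O O' : Set G} (h : Embeds R O) (h' : Embeds R' O')
    (hR : Disjoint R R') (hO : Disjoint O O') : Embeds (R ∪ R') (O ∪ O') := by
  obtain ⟨A, hA, hs, hr, rfl, hAO⟩ := h
  obtain ⟨A', hA', hs', hr', rfl, hAO'⟩ := h'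
  have hss : ∀ a ∈ A, ∀ b ∈ A', src a ≠ src b := fun a ha b hb hab =>
    Set.disjoint_left.1 hR ⟨a, ha, rfl⟩ ⟨b, hb, hab.symm⟩
  have hrr : ∀ a ∈ A, ∀ b ∈ A', rng a ≠ rng b := fun a ha b hb hab =>
    Set.disjoint_left.1 hO (hAO ⟨a, ha, rfl⟩) (hAO' ⟨b, hb, hab.symm⟩)
  have hd : Disjoint A A' := Set.disjoint_left.2 fun a ha ha' => hss a ha a ha' rfl
  refine ⟨A ∪ A', hA.union hA', (injOn_union hd).2 ⟨hs, hs', hss⟩,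
    (injOn_union hd).2 ⟨hr, hr', hrr⟩, image_union _ _ _, ?_⟩
  rw [image_union]
  exact union_subset_union hAO hAO'

theorem IsAmple.exists_section (hG : IsAmple G) {S U : Set G} (hS : IsCompactOpen S)
    (hU : IsOpen U) (h : S ⊆ src '' U) :
    ∃ A, IsCompactOpen A ∧ A ⊆ U ∧ InjOn src A ∧ src '' A = S := by
  obtain ⟨T, hT, hTS, hP⟩ := hG.exists_glue hS (fun _ A => A ⊆ U ∧ A.Nonempty ∧ A.Subsingleton) (by
    intro u hu
    obtain ⟨a, ha, rfl⟩ := h hu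
    obtain ⟨Q, hQ, hs, -, haQ, hQU⟩ := hG.exists_subset hU ha
    refine ⟨Q, hQ, ?_⟩
    filter_upwards [hQ.image_src.2.mem_nhds ⟨a, haQ, rfl⟩] with v hv _
    obtain ⟨q, hq, rfl⟩ := hv
    exact ⟨(fiber_subset _ _).trans hQU, ⟨q, hq, rfl⟩,
      fun x hx y hy => hs hx.1 hy.1 (hx.2.trans hy.2.symm)⟩)
  have hmem : ∀ {g}, g ∈ T → src g ∈ S := fun hg => hTS ⟨_, hg, rfl⟩
  refine ⟨T, hT, fun g hg => (hP _ (hmem hg)).1 ⟨hg, rfl⟩, fun g hg g' hg' hgg' => ?_,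
    hTS.antisymm fun v hv => ?_⟩
  · exact (hP _ (hmem hg)).2.2 ⟨hg, rfl⟩ ⟨hg', hgg'.symm⟩
  · obtain ⟨g, hg⟩ := (hP v hv).2.1
    exact ⟨g, hg.1, hg.2⟩

variable [CompactSpace (unitSpace G)]

/-- The ranges of the inner columns and the sources of the bisections `A k` form an open cover of
the compact, totally disconnected unit space, which can be shrunk to a compact open one. Compact
open sections over the two pieces replace the open data. -/
theorem exists_compactOpen_columns (hG : IsAmple G) (hae : IsAlmostElementary G) {K O : Set G}
    (hK : IsCompact K) (hKu : unitSpace G ⊆ K) (hO : IsOpen O) (hOu : O ⊆ unitSpace G)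
    (hne : O.Nonempty) :
    ∃ TC TD : Set G, IsCompactOpen TC ∧ IsOpen TD ∧ InjOn rng TD ∧ setMul K TC ⊆ TD ∧
      Embeds (unitSpace G \ rng '' TC) O := by
  obtain ⟨TC, TD, hTC, hTD, hCD, hinj, hKT, n, A, hA, hcov, hdis, hAO⟩ :=
    hae.exists_columns hK hKu hO hOu hne
  set U := ⋃ k, A k with hU
  have hUo : IsOpen U := isOpen_iUnion fun k => (hA k).1
  have hUr : InjOn rng U := by
    intro a ha b hb hab
    obtain ⟨k, ha⟩ := mem_iUnion.1 ha
    obtain ⟨k', hb⟩ := mem_iUnion.1 hb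
    obtain rfl : k = k' := by
      by_contra hne
      exact Set.disjoint_left.1 (hdis hne) ⟨a, ha, rfl⟩ ⟨b, hb, hab.symm⟩
    exact (hA k).2.injOn_rng ha hb hab
  have hX := isCompactOpen_unitSpace G
  obtain ⟨S, hS, hXS, hSU⟩ := hG.exists_between (hX.1.diff (isOpenMap_src U hUo))
    (isOpenMap_rng TC hTC) (by
      rintro x ⟨hx, hxU⟩
      by_contra hxT
      refine hxU ?_
      rw [hU, image_iUnion]
      exact hcov ⟨hx, hxT⟩)
  obtain ⟨B, hB, hBT, -, hBS⟩ := hG.exists_section hS (isOpen_setInv hTC) (by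
    intro x hx
    obtain ⟨t, ht, rfl⟩ := hSU hx
    exact ⟨t†, inv_mem_setInv ht, src_inv t⟩)
  have hBT' : setInv B ⊆ TC := fun b hb => by
    have : b†† ∈ TC := hBT hb
    rwa [inv_inv] at this
  have hrB : S ⊆ rng '' setInv B := by
    intro x hx
    rw [← hBS] at hx
    obtain ⟨b, hb, rfl⟩ := hx
    exact ⟨b†, inv_mem_setInv hb, rng_inv b⟩
  obtain ⟨A', hA', hAU, hs, hAS⟩ := hG.exists_section (hX.diff hB.setInv.image_rng) hUo (by
    rintro x ⟨hx, hxB⟩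
    by_contra hxU
    exact hxB (hrB (hXS ⟨hx, hxU⟩)))
  refine ⟨setInv B, TD, hB.setInv, hTD, hinj, (setMul_mono subset_rfl hBT').trans hKT,
    A', hA', hs, hUr.mono hAU, hAS, ?_⟩
  refine (image_mono hAU).trans ?_
  rw [hU, image_iUnion]
  exact hAO

/-- There are columns of castles which consist of Følner sets and cover most of the unit space. -/
theorem exists_folner_columns (hG : IsAmple G) (hmin : IsMinimal G) (hae : IsAlmostElementary G)
    (hfa : IsFiberwiseAmenable G) {K O : Set G} (hK : IsCompactOpen K) (hKu : unitSpace G ⊆ K)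
    {ε : ℝ} (hε : 0 < ε) (hO : IsOpen O) (hOu : O ⊆ unitSpace G) (hne : O.Nonempty) :
    ∃ T : Set G, IsCompactOpen T ∧ InjOn rng T ∧
      (∀ u ∈ unitSpace G, ((setMul K (fiber T u)).ncard : ℝ) ≤ (1 + ε) * (fiber T u).ncard) ∧
      Embeds (unitSpace G \ rng '' T) O := by
  obtain ⟨L, hL, hLF⟩ := exists_folner_superset hG hmin hfa hK hKu hε
  have hX := isCompactOpen_unitSpace G
  obtain ⟨TC, TD, hTC, hTD, hinj, hLT, hemb⟩ := exists_compactOpen_columns hG hae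
    (hL.union hX).1 subset_union_right hO hOu hne
  obtain ⟨T, hT, hTS, hP⟩ := hG.exists_glue hTC.image_src (fun v A => fiber TC v ⊆ A ∧ A ⊆ TD ∧
    ((setMul K A).ncard : ℝ) ≤ (1 + ε) * A.ncard) (by
      intro u _
      obtain ⟨F, hF, hMF, hFL, hKF⟩ := hLF _ (hG.finite_fiber hTC u)
      have hFu : ∀ x ∈ F, src x = u := by
        intro x hx
        obtain ⟨a, -, b, hb, h, rfl⟩ := mem_setMul.1 (hFL hx)
        rw [src_mul h, hb.2]
      -- The Følner enlargement stays within `L` times the inner column, hence inside `TD`, where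
      -- ranges are distinct.
      have hFD : F ⊆ TD := hFL.trans
        ((setMul_mono subset_union_left (fiber_subset _ _)).trans hLT)
      obtain ⟨Q, hQ, hQD, rfl⟩ := hG.exists_lift hF hFu hTD hFD
      refine ⟨Q, hQ, ?_⟩
      filter_upwards [hG.eventually_ncard_fiber hQ u,
        hG.eventually_ncard_fiber (hK.setMul hQ) u,
        eventually_fiber_subset hTC.1 hQ.2 (hMF.trans (fiber_subset _ _))] with v h1 h2 h3 _
      rw [fiber_setMul, fiber_setMul] at h2
      refine ⟨fun g hg => ⟨h3 hg, hg.2⟩, (fiber_subset _ _).trans hQD, ?_⟩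
      rwa [h1, h2])
  have hTD' : T ⊆ TD := fun g hg => (hP _ (hTS ⟨g, hg, rfl⟩)).2.1 ⟨hg, rfl⟩
  have hTCT : TC ⊆ T := fun g hg => ((hP _ ⟨g, hg, rfl⟩).1 ⟨hg, rfl⟩).1
  refine ⟨T, hT, hinj.mono hTD', fun u _ => ?_, hemb.mono (hX.diff hT.image_rng)
    (sdiff_subset_sdiff_right (image_mono hTCT))⟩
  by_cases hu : u ∈ src '' TC
  · exact (hP u hu).2.2
  · have : fiber T u = ∅ := by
      ext g
      simp only [mem_empty_iff_false, iff_false]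
      rintro ⟨hg, rfl⟩
      exact hu (hTS ⟨g, hg, rfl⟩)
    simp [this, setMul]

end Castles

/-! ### Smallness and comparison of subsets of the unit space -/

section Comparison

set_option linter.unusedSectionVars false

variable {G : Type*} [TopologicalSpace G] [ArrowGroupoid G] [T2Space G] [IsEtale G]
  [CompactSpace (unitSpace G)]

/-- A finite orbit is closed, so minimality would give an arrow from `v` into its complement. -/
theorem IsMinimal.infinite_orbit (hmin : IsMinimal G) (hinf : (unitSpace G).Infinite) {v : G}
    (hv : v ∈ unitSpace G) : (rng '' fiber univ v).Infinite := by
  intro hfin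
  refine hinf (hfin.subset fun w hw => ?_)
  by_contra hcon
  obtain ⟨g, hg, hgw⟩ := hmin.exists_arrow hfin.isClosed.isOpen_compl hcon hw hv
  exact hgw ⟨g, ⟨mem_univ g, hg⟩, rfl⟩

theorem IsMinimal.exists_finite_fiber (hmin : IsMinimal G) (hinf : (unitSpace G).Infinite) {v : G}
    (hv : v ∈ unitSpace G) (N : ℕ) :
    ∃ F : Set G, F.Finite ∧ F.ncard = N ∧ InjOn rng F ∧ ∀ x ∈ F, src x = v := by
  obtain ⟨s, hs, hbij⟩ := exists_subset_bijOn (fiber univ v) rng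
  have hsinf : s.Infinite := fun h => hmin.infinite_orbit hinf hv (by
    rw [← hbij.image_eq]; exact h.image _)
  obtain ⟨F, hFs, hF, hcard⟩ := hsinf.exists_subset_ncard_eq N
  exact ⟨F, hF, hcard, hbij.injOn.mono hFs, fun x hx => (hs (hFs hx)).2⟩

theorem exists_large_fibers (hG : IsAmple G) (hmin : IsMinimal G)
    (hinf : (unitSpace G).Infinite) (N : ℕ) :
    ∃ J, IsCompactOpen J ∧ ∀ v ∈ unitSpace G, N ≤ (fiber J v).ncard := by
  obtain ⟨J, hJ, -, h⟩ := hG.exists_glue (isCompactOpen_unitSpace G) (fun _ A => N ≤ A.ncard) (by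
    intro u hu
    obtain ⟨F, hF, hcard, -, hFu⟩ := hmin.exists_finite_fiber hinf hu N
    obtain ⟨Q, hQ, -, hQF⟩ := hG.exists_lift hF hFu isOpen_univ (subset_univ _)
    refine ⟨Q, hQ, ?_⟩
    filter_upwards [hG.eventually_ncard_fiber hQ u] with v hv _
    rw [hv, hQF, hcard])
  exact ⟨J, hJ, h⟩

/-- Every point of `O` is the source of at least `N` elements of `J`, and the ranges of the elements
of `J` are all distinct: there are `N` disjoint copies of `O`. -/
structure IsSmall (N : ℕ) (J O : Set G) : Prop where
  isCompactOpen : IsCompactOpen J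
  injOn : InjOn rng J
  le_ncard : ∀ u ∈ O, N ≤ (fiber J u).ncard

theorem exists_isSmall (hG : IsAmple G) (hmin : IsMinimal G)
    (hinf : (unitSpace G).Infinite) (N : ℕ) {Y : Set G} (hY : IsOpen Y) (hYu : Y ⊆ unitSpace G)
    (hne : Y.Nonempty) : ∃ O J, IsCompactOpen O ∧ O.Nonempty ∧ O ⊆ Y ∧ IsSmall N J O := by
  obtain ⟨u, hu⟩ := hne
  obtain ⟨F, hF, hcard, hFr, hFu⟩ := hmin.exists_finite_fiber hinf (hYu hu) N
  -- Injectivity of `rng` on `N` arrows out of one point persists on a neighbourhood of them, since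
  -- `rng` is locally injective.
  obtain ⟨Ω, hΩ, hFΩ, hinj⟩ := hFr.exists_isOpen_superset hF.isCompact
    (fun x _ => continuous_rng.continuousAt) fun x _ => by
      obtain ⟨Q, hQ, -, hr, hx, -⟩ := hG.exists_subset isOpen_univ (mem_univ x)
      exact ⟨Q, hQ.2.mem_nhds hx, hr⟩
  obtain ⟨J, hJ, hJΩ, hJF⟩ := hG.exists_lift hF hFu hΩ hFΩ
  obtain ⟨W, hW, hWo, huW⟩ := eventually_nhds_iff.1 (hG.eventually_ncard_fiber hJ u)
  obtain ⟨O, hO, -, -, huO, hOW⟩ := hG.exists_subset (hWo.inter hY) ⟨huW, hu⟩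
  refine ⟨O, J, hO, ⟨u, huO⟩, hOW.trans inter_subset_right, hJ, hinj.mono hJΩ, fun v hv => ?_⟩
  rw [hW v (hOW hv).1, hJF, hcard]

theorem IsSmall.mul_ncard_le (hG : IsAmple G) {N : ℕ} {J O : Set G} (h : IsSmall N J O) (hN : 0 < N)
    {F : Set G} (hF : F.Finite) :
    (N : ℝ) * (F ∩ rng ⁻¹' O).ncard ≤ (setMul J F).ncard := by
  have hJf := hG.finite_fiber h.isCompactOpen
  refine (EtaleGpd.mul_ncard_le (J := J) (by exact_mod_cast hN) (hF.subset inter_subset_left) hJf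
    (fun x _ y _ hxy => disjoint_translates h.injOn hxy)
    fun x hx => by exact_mod_cast h.le_ncard _ hx.2).trans ?_
  exact_mod_cast ncard_le_ncard (setMul_mono subset_rfl inter_subset_left) (finite_setMul hJf hF)

/-- Composing the `N` copies of `O` with the arrows that carry `R` into `O` gives `N` disjoint
copies of `R`. -/
theorem IsSmall.of_embeds (hG : IsAmple G) {N : ℕ} {J O R : Set G} (h : IsSmall N J O)
    (hR : Embeds R O) : ∃ J', IsSmall N J' R := by
  obtain ⟨A, hA, hs, hr, rfl, hAO⟩ := hR
  have hJA := h.isCompactOpen.setMul hA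
  refine ⟨setMul J A, hJA, ?_, ?_⟩
  · intro g hg g' hg' hgg'
    obtain ⟨j, hj, a, ha, hja, rfl⟩ := mem_setMul.1 hg
    obtain ⟨j', hj', a', ha', hja', rfl⟩ := mem_setMul.1 hg'
    rw [rng_mul hja, rng_mul hja'] at hgg'
    obtain rfl := h.injOn hj hj' hgg'
    obtain rfl := hr ha ha' (hja.symm.trans hja')
    rfl
  · rintro _ ⟨a, ha, rfl⟩
    rw [fiber_setMul]
    refine (h.le_ncard (rng a) (hAO ⟨a, ha, rfl⟩)).trans ?_
    rw [← ncard_setMul_singleton]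
    exact ncard_le_ncard (setMul_mono subset_rfl (singleton_subset_iff.2 ⟨ha, rfl⟩))
      (finite_setMul (hG.finite_fiber h.isCompactOpen) (hG.finite_fiber hA _))

/-- The arrows `p' ⋆ p†` join the unique point of a column in `P` to the unique point of the same
column in `P'`. -/
theorem embeds_of_fiber_ncard_le_one {P P' : Set G} (hP : IsCompactOpen P) (hP' : IsCompactOpen P')
    (hPf : ∀ u, (fiber P u).Subsingleton) (hPf' : ∀ u, (fiber P' u).Subsingleton)
    (hr : InjOn rng P) (hr' : InjOn rng P') (h : ∀ u, (fiber P u).Nonempty → (fiber P' u).Nonempty) :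
    Embeds (rng '' P) (rng '' P') := by
  refine ⟨setMul P' (setInv P), hP'.setMul hP.setInv, ?_, ?_, ?_, ?_⟩
  · intro g hg g' hg' hgg'
    obtain ⟨p', hp', p, hp, hpp, rfl⟩ := mem_setMul_setInv.1 hg
    obtain ⟨q', hq', q, hq, hqq, rfl⟩ := mem_setMul_setInv.1 hg'
    rw [src_mul_inv hpp, src_mul_inv hqq] at hgg'
    obtain rfl := hr hp hq hgg'
    obtain rfl := hPf' _ ⟨hp', hpp⟩ ⟨hq', hqq⟩
    rfl
  · intro g hg g' hg' hgg'
    obtain ⟨p', hp', p, hp, hpp, rfl⟩ := mem_setMul_setInv.1 hg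
    obtain ⟨q', hq', q, hq, hqq, rfl⟩ := mem_setMul_setInv.1 hg'
    rw [rng_mul_inv hpp, rng_mul_inv hqq] at hgg'
    obtain rfl := hr' hp' hq' hgg'
    obtain rfl := hPf _ ⟨hp, hpp.symm⟩ ⟨hq, hqq.symm⟩
    rfl
  · ext x
    constructor
    · rintro ⟨g, hg, rfl⟩
      obtain ⟨p', hp', p, hp, hpp, rfl⟩ := mem_setMul_setInv.1 hg
      exact ⟨p, hp, (src_mul_inv hpp).symm⟩
    · rintro ⟨p, hp, rfl⟩
      obtain ⟨p', hp', hpp⟩ := h (src p) ⟨p, hp, rfl⟩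
      exact ⟨p' ⋆ p†, mem_setMul_setInv.2 ⟨p', hp', p, hp, hpp, rfl⟩, src_mul_inv hpp⟩
  · rintro _ ⟨g, hg, rfl⟩
    obtain ⟨p', hp', p, hp, hpp, rfl⟩ := mem_setMul_setInv.1 hg
    exact ⟨p', hp', (rng_mul_inv hpp).symm⟩

/-- Inside the columns of a castle, sets with fewer points embed into sets with more points. -/
theorem embeds_of_ncard_le (hG : IsAmple G) {T : Set G} (hT : InjOn rng T) {P P' : Set G}
    (hP : IsCompactOpen P) (hP' : IsCompactOpen P') (hPT : P ⊆ T) (hPT' : P' ⊆ T)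
    (h : ∀ u ∈ unitSpace G, (fiber P u).ncard ≤ (fiber P' u).ncard) :
    Embeds (rng '' P) (rng '' P') := by
  obtain ⟨n, hn⟩ := hG.exists_ncard_fiber_le hP
  induction n generalizing P P' with
  | zero =>
    have : P = ∅ := subset_empty_iff.1 (subset_of_fiber_subset fun u _ => by
      rw [(ncard_eq_zero (hG.finite_fiber hP u)).1 (Nat.le_zero.1 (hn u))])
    subst this
    exact ⟨∅, .empty, injOn_empty _, injOn_empty _, by simp, by simp⟩
  | succ n ih =>
    -- One point is matched in every column that meets `P`; removing the matched points lowers the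
    -- bound on the column counts by one.
    have hloc : ∀ u ∈ unitSpace G, ∀ᶠ v in 𝓝 u,
        min 1 (fiber P v).ncard = min 1 (fiber P u).ncard := fun u _ => by
      filter_upwards [hG.eventually_ncard_fiber hP u] with v hv
      rw [hv]
    obtain ⟨P₀, hP₀, hPP₀, hcard⟩ := hG.exists_ncard_fiber_eq hP _ hloc fun u _ => min_le_right _ _
    obtain ⟨P₀', hP₀', hPP₀', hcard'⟩ := hG.exists_ncard_fiber_eq hP' _ hloc
      fun u hu => (min_le_right _ _).trans (h u hu)
    have hdiff : ∀ {A B : Set G}, IsCompactOpen A → IsCompactOpen B → B ⊆ A → ∀ u,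
        (fiber (A \ B) u).ncard = (fiber A u).ncard - (fiber B u).ncard := by
      intro A B _ hB hBA u
      rw [← ncard_sdiff (fiber_mono hBA u) (hG.finite_fiber hB u)]
      congr 1
      ext g
      simp only [fiber, mem_sdiff, mem_ofPred_eq]
      tauto
    have hdis : ∀ {A B : Set G}, A ⊆ T → B ⊆ A → rng '' A = rng '' B ∪ rng '' (A \ B) ∧
        Disjoint (rng '' B) (rng '' (A \ B)) := by
      intro A B hA hB
      refine ⟨by rw [← image_union, union_sdiff_cancel hB], ?_⟩
      rw [Set.disjoint_left]
      rintro _ ⟨b, hb, rfl⟩ ⟨c, hc, hcb⟩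
      obtain rfl := hT (hA hc.1) (hA (hB hb)) hcb
      exact hc.2 hb
    have hsing : ∀ {A : Set G}, IsCompactOpen A →
        (∀ u ∈ unitSpace G, (fiber A u).ncard = min 1 (fiber P u).ncard) →
        ∀ u, (fiber A u).Subsingleton := by
      intro A hA hAc u a ha b hb
      have hu : u ∈ unitSpace G := ha.2 ▸ src_mem a
      have : Finite (fiber A u) := hG.finite_fiber hA u
      exact ncard_le_one_iff_subsingleton.1 (by rw [hAc u hu]; exact min_le_left _ _) ha hb
    rw [(hdis hPT hPP₀).1, (hdis hPT' hPP₀').1]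
    refine Embeds.union ?_ ?_ (hdis hPT hPP₀).2 (hdis hPT' hPP₀').2
    · refine embeds_of_fiber_ncard_le_one hP₀ hP₀' (hsing hP₀ hcard) (hsing hP₀' hcard')
        (hT.mono (hPP₀.trans hPT)) (hT.mono (hPP₀'.trans hPT')) fun u hne => ?_
      have hu : u ∈ unitSpace G := by
        obtain ⟨a, ha⟩ := hne
        exact ha.2 ▸ src_mem a
      rw [← ncard_pos (hG.finite_fiber hP₀' u), hcard' u hu, ← hcard u hu,
        ncard_pos (hG.finite_fiber hP₀ u)]
      exact hne
    · refine ih (hP.diff hP₀) (hP'.diff hP₀') (sdiff_subset.trans hPT) (sdiff_subset.trans hPT')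
        (fun u hu => ?_) fun u => ?_
      · rw [hdiff hP hP₀ hPP₀, hdiff hP' hP₀' hPP₀', hcard u hu, hcard' u hu]
        exact Nat.sub_le_sub_right (h u hu) _
      · rw [hdiff hP hP₀ hPP₀]
        by_cases hu : u ∈ unitSpace G
        · rw [hcard u hu]
          have := hn u
          lia
        · have : fiber P u = ∅ := by
            ext g
            simp only [mem_empty_iff_false, iff_false]
            rintro ⟨-, rfl⟩
            exact hu (src_mem g)
          simp [this]

end Comparison

/-! ### From columns to almost finiteness -/

section Reduction

set_option linter.unusedSectionVars false

variable {G : Type*} [TopologicalSpace G] [ArrowGroupoid G] [T2Space G] [IsEtale G]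

theorem IsAmple.exists_coloring (hG : IsAmple G) {T : Set G} (hT : IsCompactOpen T) :
    ∃ (n : ℕ) (c : G → ℕ), (∀ g ∈ T, c g < n) ∧
      ∀ i, IsCompactOpen (T ∩ c ⁻¹' {i}) ∧ InjOn src (T ∩ c ⁻¹' {i}) := by
  classical
  refine hG.induction (p := fun T => ∃ (n : ℕ) (c : G → ℕ), (∀ g ∈ T, c g < n) ∧
      ∀ i, IsCompactOpen (T ∩ c ⁻¹' {i}) ∧ InjOn src (T ∩ c ⁻¹' {i})) ?_ ?_ ?_ hT
  · exact ⟨0, fun _ => 0, by simp, fun i => by simpa using IsCompactOpen.empty⟩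
  · intro B hB hs _
    refine ⟨1, fun _ => 0, by simp, fun i => ⟨?_, hs.mono inter_subset_left⟩⟩
    by_cases hi : i = 0
    · subst hi
      convert hB using 1
      ext g; simp
    · convert IsCompactOpen.empty using 1
      ext g; simp [Ne.symm hi]
  · rintro A B hA hB hd ⟨n, c, hc, h⟩ ⟨n', c', hc', h'⟩
    refine ⟨n + n', fun g => if g ∈ A then c g else n + c' g, ?_, fun i => ?_⟩
    · rintro g (hg | hg)
      · have := hc g hg
        simp only [hg, if_true]; lia
      · have hgA : g ∉ A := fun hgA => Set.disjoint_left.1 hd hgA hg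
        have := hc' g hg
        simp only [hgA, if_false]; lia
    · have key : ((A ∪ B) ∩ (fun g => if g ∈ A then c g else n + c' g) ⁻¹' {i}) =
          if i < n then A ∩ c ⁻¹' {i} else B ∩ c' ⁻¹' {i - n} := by
        ext g
        by_cases hgA : g ∈ A
        · have hgB : g ∉ B := fun hgB => Set.disjoint_left.1 hd hgA hgB
          have := hc g hgA
          split_ifs with hi <;> simp [hgA, hgB]
          lia
        · by_cases hgB : g ∈ B
          · have := hc' g hgB
            split_ifs with hi <;> simp [hgA, hgB] <;> lia
          · split_ifs with hi <;> simp [hgA, hgB]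
      rw [key]
      split_ifs
      exacts [h i, h' _]

/-- A compact open set of columns generates an elementary groupoid. -/
theorem isElementary_of_columns (hG : IsAmple G) {T : Set G} (hT : IsCompactOpen T)
    (hr : InjOn rng T) : IsElementary (setMul T (setInv T)) := by
  classical
  obtain ⟨n, c, hc, hB⟩ := hG.exists_coloring hT
  set B : ℕ → Set G := fun i => T ∩ c ⁻¹' {i} with hBdef
  -- The colors are the rungs, and the towers are indexed by the set of colors occurring over a base
  -- point. This set is locally constant, which makes the multisections open and complete.
  set pat : G → Finset ℕ := fun v => (Finset.range n).filter fun i => v ∈ src '' B i with hpat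
  set 𝒮 := (Finset.range n).powerset
  set e := 𝒮.equivFin
  set S : Fin 𝒮.card → Finset ℕ := fun l => (e.symm l : Finset ℕ) with hS
  have hSinj : ∀ {l l'}, S l = S l' → l = l' := fun h => e.symm.injective (Subtype.ext h)
  have hpatS : ∀ v, ∃ l, S l = pat v := fun v =>
    ⟨e ⟨pat v, Finset.mem_powerset.2 (Finset.filter_subset _ _)⟩, by simp [hS]⟩
  have hBT : ∀ {i g}, g ∈ B i → g ∈ T := fun hg => hg.1
  have hBi : ∀ {i g}, g ∈ B i → c g = i := fun hg => hg.2
  set D : Fin 𝒮.card → ℕ → ℕ → Set G := fun l i j =>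
    {g | ∃ a ∈ B i, ∃ b ∈ B j, src a = src b ∧ pat (src a) = S l ∧ a ⋆ b† = g} with hD
  have hW : ∀ l, IsOpen {v | pat v = S l} := by
    intro l
    rw [isOpen_iff_mem_nhds]
    intro v hv
    have : ∀ᶠ w in 𝓝 v, ∀ i ∈ Finset.range n, (w ∈ src '' B i ↔ v ∈ src '' B i) :=
      (Filter.eventually_all_finset _).2 fun i _ => (hB i).1.image_src.eventually_mem_iff v
    filter_upwards [this] with w hw
    have hv' : pat v = S l := hv
    change pat w = S l
    rw [← hv']
    exact Finset.filter_congr hw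
  have hDo : ∀ l i j, IsOpen (D l i j) := by
    intro l i j
    convert isOpen_setMul ((hB i).1.2.inter ((hW l).preimage continuous_src))
      (isOpen_setInv (hB j).1.2) using 1
    ext g
    rw [mem_setMul_setInv]
    constructor
    · rintro ⟨a, ha, b, hb, h, hp, rfl⟩
      exact ⟨a, ⟨ha, hp⟩, b, hb, h, rfl⟩
    · rintro ⟨a, ⟨ha, hp⟩, b, hb, h, rfl⟩
      exact ⟨a, ha, b, hb, h, hp, rfl⟩
  refine ⟨𝒮.card, S, D, ⟨fun l => ⟨?_, ?_, ?_, ?_⟩, ?_, fun l i _ j _ => hDo l i j⟩, ?_⟩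
  · intro i _ j _
    refine isBisection_of_injOn (hDo l i j) ?_ ?_
    · rintro _ ⟨a, ha, b, hb, h, -, rfl⟩ _ ⟨a', ha', b', hb', h', -, rfl⟩ hab
      rw [src_mul_inv h, src_mul_inv h'] at hab
      obtain rfl := hr (hBT hb) (hBT hb') hab
      obtain rfl := (hB i).2 ha ha' (h.trans h'.symm)
      rfl
    · rintro _ ⟨a, ha, b, hb, h, -, rfl⟩ _ ⟨a', ha', b', hb', h', -, rfl⟩ hab
      rw [rng_mul_inv h, rng_mul_inv h'] at hab
      obtain rfl := hr (hBT ha) (hBT ha') hab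
      obtain rfl := (hB j).2 hb hb' (h.symm.trans h')
      rfl
  · intro i _ j hj k _
    ext g
    rw [mem_setMul]
    constructor
    · rintro ⟨_, ⟨a, ha, b, hb, h, hp, rfl⟩, _, ⟨a', ha', b', hb', h', -, rfl⟩, hcomp, rfl⟩
      rw [src_mul_inv h, rng_mul_inv h'] at hcomp
      obtain rfl := hr (hBT hb) (hBT ha') hcomp
      exact ⟨a, ha, b', hb', h.trans h', hp, (mul_inv_mul_mul_inv h h').symm⟩
    · rintro ⟨a, ha, b, hb, h, hp, rfl⟩
      have hj' : j ∈ pat (src a) := by rw [hp]; exact hj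
      obtain ⟨x, hx, hxa⟩ := (Finset.mem_filter.1 hj').2
      refine ⟨a ⋆ x†, ⟨a, ha, x, hx, hxa.symm, hp, rfl⟩, x ⋆ b†,
        ⟨x, hx, b, hb, hxa.trans h, by rw [hxa, hp], rfl⟩, ?_, mul_inv_mul_mul_inv hxa.symm
        (hxa.trans h)⟩
      rw [src_mul_inv hxa.symm, rng_mul_inv (hxa.trans h)]
  · rintro i _ _ ⟨a, ha, b, hb, h, -, rfl⟩
    obtain rfl := (hB i).2 ha hb h
    exact rng_mem a
  · intro i _ j _ hij
    rw [Set.disjoint_left]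
    rintro _ ⟨a, ha, b, hb, h, -, rfl⟩ ⟨a', ha', b', hb', h', -, hab⟩
    have : rng a' = rng a := by rw [← rng_mul_inv h, ← hab, rng_mul_inv h']
    obtain rfl := hr (hBT ha') (hBT ha) this
    exact hij ((hBi ha).symm.trans (hBi ha'))
  · intro l l' hll i _ j _ i' _ j' _
    rw [← subset_empty_iff]
    rintro g hg
    obtain ⟨_, ⟨a, ha, b, hb, h, hp, rfl⟩, _, ⟨a', ha', b', hb', h', hp', rfl⟩, hcomp, rfl⟩ :=
      mem_setMul.1 hg
    rw [src_mul_inv h, rng_mul_inv h'] at hcomp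
    obtain rfl := hr (hBT hb) (hBT ha') hcomp
    exact hll (hSinj (by rw [← hp, h, hp']))
  · ext g
    rw [mem_setMul_setInv]
    simp only [multisectionUnion, mem_iUnion, exists_prop]
    constructor
    · rintro ⟨a, ha, b, hb, h, rfl⟩
      obtain ⟨l, hl⟩ := hpatS (src a)
      have haB : a ∈ B (c a) := ⟨ha, rfl⟩
      have hbB : b ∈ B (c b) := ⟨hb, rfl⟩
      refine ⟨l, c a, ?_, c b, ?_, a, haB, b, hbB, h, hl.symm, rfl⟩
      · rw [hl]
        exact Finset.mem_filter.2 ⟨Finset.mem_range.2 (hc a ha), a, haB, rfl⟩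
      · rw [hl]
        exact Finset.mem_filter.2 ⟨Finset.mem_range.2 (hc b hb), b, hbB, h.symm⟩
    · rintro ⟨l, i, -, j, -, a, ha, b, hb, h, -, rfl⟩
      exact ⟨a, hBT ha, b, hBT hb, h, rfl⟩

theorem isSubgroupoid_of_columns {T : Set G} (hr : InjOn rng T) :
    IsSubgroupoid (setMul T (setInv T)) := by
  constructor
  · intro g hg
    obtain ⟨x, hx, y, hy, hxy, rfl⟩ := mem_setMul.1 hg
    obtain ⟨a, ha, b, hb, h, rfl⟩ := mem_setMul_setInv.1 hx
    obtain ⟨a', ha', b', hb', h', rfl⟩ := mem_setMul_setInv.1 hy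
    rw [src_mul_inv h, rng_mul_inv h'] at hxy
    obtain rfl := hr hb ha' hxy
    exact mem_setMul_setInv.2 ⟨a, ha, b', hb', h.trans h', (mul_inv_mul_mul_inv h h').symm⟩
  · intro g hg
    obtain ⟨a, ha, b, hb, h, rfl⟩ := mem_setMul_setInv.1 hg
    exact mem_setMul_setInv.2 ⟨b, hb, a, ha, h.symm, (inv_mul_inv h).symm⟩

theorem setMul_singleton_sdiff {G : Type*} [ArrowGroupoid G] (A B : Set G) (x : G) :
    setMul A {x} \ setMul B {x} = setMul (A \ B) {x} := by
  ext g
  simp only [mem_sdiff, mem_setMul, mem_singleton_iff, exists_eq_left]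
  constructor
  · rintro ⟨⟨a, ha, h, rfl⟩, hB⟩
    exact ⟨a, ⟨ha, fun haB => hB ⟨a, haB, h, rfl⟩⟩, h, rfl⟩
  · rintro ⟨a, ⟨ha, haB⟩, h, rfl⟩
    refine ⟨⟨a, ha, h, rfl⟩, ?_⟩
    rintro ⟨b, hb, h', hab⟩
    exact haB (mul_right_cancel h' h hab ▸ hb)

theorem fiber_sdiff {G : Type*} [ArrowGroupoid G] (A B : Set G) (u : G) :
    fiber (A \ B) u = fiber A u \ fiber B u := by
  ext g
  simp only [fiber, mem_sdiff, mem_ofPred_eq]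
  tauto

/-- Almost finiteness in terms of the columns of the castle. -/
theorem isAlmostFinite_of_columns [CompactSpace (unitSpace G)] (hG : IsAmple G)
    (h : ∀ K : Set G, IsCompactOpen K → unitSpace G ⊆ K → ∀ ε : ℝ, 0 < ε →
      ∃ T : Set G, IsCompactOpen T ∧ InjOn rng T ∧ rng '' T = unitSpace G ∧
        ∀ u ∈ src '' T, ((setMul K (fiber T u) \ fiber T u).ncard : ℝ) < ε * (fiber T u).ncard) :
    IsAlmostFinite G := by
  intro K hK ε hε
  have hX := isCompactOpen_unitSpace G
  obtain ⟨K', hK', hKK', -⟩ := hG.exists_between (hK.union hX.1) isOpen_univ (subset_univ _)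
  rw [union_subset_iff] at hKK'
  obtain ⟨T, hT, hr, hTX, hF⟩ := h K' hK' hKK'.2 ε hε
  refine ⟨setMul T (setInv T), isSubgroupoid_of_columns hr, (hT.setMul hT.setInv).1,
    (hT.setMul hT.setInv).2, isElementary_of_columns hG hT hr, ?_, ?_⟩
  · rw [inter_eq_right, ← hTX]
    rintro _ ⟨t, ht, rfl⟩
    exact mem_setMul_setInv.2 ⟨t, ht, t, ht, rfl, rfl⟩
  · intro u hu
    rw [← hTX] at hu
    obtain ⟨t, ht, rfl⟩ := hu
    -- The fiber of `T T⁻¹` over `rng t` is a right translate of the column through `t`, so the two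
    -- have boundaries of the same size.
    have hfib : fiber (setMul T (setInv T)) (rng t) = setMul T {t†} := by
      rw [fiber_setMul]
      congr 1
      ext g
      constructor
      · rintro ⟨hg, hgt⟩
        rw [← rng_inv] at hgt
        rw [mem_singleton_iff, ← hr hg ht hgt, inv_inv]
      · rintro rfl
        exact ⟨inv_mem_setInv ht, src_inv t⟩
    have hTf := hG.finite_fiber hT
    have hKf := hG.finite_fiber hK'
    have hfin : (setMul K' (setMul T {t†}) \ setMul T {t†}).Finite :=
      (finite_setMul hKf (finite_setMul hTf (finite_singleton _))).sdiff
    have hsub : setMul K (setMul T {t†}) \ setMul T {t†} ⊆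
        setMul K' (setMul T {t†}) \ setMul T {t†} :=
      sdiff_subset_sdiff_left (setMul_mono hKK'.1 subset_rfl)
    rw [hfib]
    refine ⟨finite_setMul hTf (finite_singleton _), hfin.subset hsub, ?_⟩
    have h1 := hF (src t) ⟨t, ht, rfl⟩
    rw [← fiber_setMul, ← fiber_sdiff, ← rng_inv, ← ncard_setMul_singleton,
      ← ncard_setMul_singleton, ← setMul_singleton_sdiff, setMul_assoc] at h1
    exact lt_of_le_of_lt (by exact_mod_cast ncard_le_ncard hsub hfin) h1

end Reduction

/-! ### Absorbing the remainder -/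

section Main

set_option linter.unusedSectionVars false

variable {G : Type*} [TopologicalSpace G] [ArrowGroupoid G] [T2Space G] [IsEtale G]
  [CompactSpace (unitSpace G)]

theorem fiber_inter_rng {G : Type*} [ArrowGroupoid G] (T S : Set G) (u : G) :
    fiber (T ∩ rng ⁻¹' S) u = fiber T u ∩ rng ⁻¹' S := by
  ext g
  simp only [fiber, mem_inter_iff, mem_ofPred_eq]
  tauto

/-- The `N` disjoint copies of `F ∩ rng ⁻¹' O` all lie in `K F`, which has at most `2 |F|` elements.
-/
theorem IsSmall.ncard_le (hG : IsAmple G) {N : ℕ} {J O K F : Set G} {δ : ℝ} (h : IsSmall N J O)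
    (hδ : 0 < δ) (hN : 32 / δ ≤ N) (hF : F.Finite) (hKF : (setMul K F).Finite)
    (hJK : J ⊆ K) (hK : ((setMul K F).ncard : ℝ) ≤ 2 * F.ncard) :
    ((F ∩ rng ⁻¹' O).ncard : ℝ) ≤ δ / 16 * F.ncard := by
  have hN0 : (0 : ℝ) < N := lt_of_lt_of_le (by positivity) hN
  have h1 := h.mul_ncard_le hG (by exact_mod_cast hN0) hF
  have h2 : ((setMul J F).ncard : ℝ) ≤ (setMul K F).ncard := by
    exact_mod_cast ncard_le_ncard (setMul_mono hJK subset_rfl) hKF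
  have h3 : 32 / δ * (F ∩ rng ⁻¹' O).ncard ≤ 2 * F.ncard :=
    (mul_le_mul_of_nonneg_right hN (by positivity)).trans (h1.trans (h2.trans hK))
  rw [div_mul_eq_mul_div, div_le_iff₀ hδ] at h3
  linarith

/-- If every column of `T` contains sufficiently many points of `P`, then the columns of any
sufficiently invariant finite set contain many points with range in `r(P)`. -/
theorem le_ncard_inter_rng (hG : IsAmple G) {T P K F : Set G} {δ : ℝ} (hT : IsCompactOpen T)
    (hr : InjOn rng T) (hP : IsCompactOpen P) (hPT : P ⊆ T) (hδ : 0 < δ)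
    (hTP : ∀ u ∈ unitSpace G, ((fiber T u).ncard : ℝ) ≤ 2 / δ * (fiber P u).ncard)
    (hK : IsCompactOpen K) (hKu : unitSpace G ⊆ K) (hTK : setMul T (setInv T) ⊆ K)
    (hF : F.Finite) (hKF : ((setMul K F).ncard : ℝ) ≤ (1 + δ / 16) * F.ncard)
    (hFT : (F.ncard : ℝ) / 2 ≤ (F ∩ rng ⁻¹' (rng '' T)).ncard) :
    3 * δ / 16 * F.ncard ≤ (F ∩ rng ⁻¹' (rng '' P)).ncard := by
  -- Base points of the columns of `T` through `F`, moved into the fibers of `F`. Thus `T Z` covers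
  -- the part of `F` over the levels, and `P Z` leaves `F` only through `K F \ F`. The constant is
  -- `δ / 4 - δ / 16 = 3 * δ / 16`.
  set Z := setMul (setInv T) F with hZ
  have hZf : Z.Finite := finite_setMul (hG.finite_fiber hT.setInv) hF
  have hKFf : (setMul K F).Finite := finite_setMul (hG.finite_fiber hK) hF
  have h1 : F ∩ rng ⁻¹' (rng '' T) ⊆ setMul T Z := by
    rintro x ⟨hx, t, ht, htx⟩
    rw [← mul_inv_cancel_left htx]
    refine mul_mem_setMul ht (mul_mem_setMul (inv_mem_setInv ht) hx (by rw [src_inv, htx])) ?_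
    rw [rng_mul (by rw [src_inv, htx]), rng_inv]
  have h2 : ((setMul T Z).ncard : ℝ) ≤ 2 / δ * (setMul P Z).ncard :=
    ncard_setMul_le hZf (hG.finite_fiber hP)
      (fun x _ y _ hxy => disjoint_translates (hr.mono hPT) hxy) fun x _ => hTP _ (rng_mem x)
  have h3 : setMul P Z ⊆ setMul K F := by
    rw [hZ, ← setMul_assoc]
    exact setMul_mono ((setMul_mono hPT subset_rfl).trans hTK) subset_rfl
  have h4 : setMul P Z ⊆ (F ∩ rng ⁻¹' (rng '' P)) ∪ (setMul K F \ F) := by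
    intro g hg
    by_cases hgF : g ∈ F
    · obtain ⟨p, hp, z, -, hpz, rfl⟩ := mem_setMul.1 hg
      exact Or.inl ⟨hgF, p, hp, (rng_mul hpz).symm⟩
    · exact Or.inr ⟨h3 hg, hgF⟩
  have h5 : ((setMul P Z).ncard : ℝ) ≤
      (F ∩ rng ⁻¹' (rng '' P)).ncard + (setMul K F \ F).ncard := by
    exact_mod_cast (ncard_le_ncard h4 ((hF.subset inter_subset_left).union hKFf.sdiff)).trans
      (ncard_union_le _ _)
  have h6 : ((setMul K F \ F).ncard : ℝ) + F.ncard = (setMul K F).ncard := by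
    exact_mod_cast ncard_sdiff_add_ncard_of_subset (subset_setMul hKu F) hKFf
  have h7 : ((F ∩ rng ⁻¹' (rng '' T)).ncard : ℝ) ≤ (setMul T Z).ncard := by
    exact_mod_cast ncard_le_ncard h1 (finite_setMul (hG.finite_fiber hT) hZf)
  have h8 : (F.ncard : ℝ) / 2 ≤ 2 / δ * (setMul P Z).ncard := hFT.trans (h7.trans h2)
  rw [div_mul_eq_mul_div, le_div_iff₀ hδ] at h8
  linarith

/-- The complement of the levels of a castle embeds into any set which meets all columns
sufficiently often, if this complement is small. -/
theorem embeds_of_isSmall (hG : IsAmple G) (hmin : IsMinimal G) (hinf : (unitSpace G).Infinite)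
    (hae : IsAlmostElementary G) (hfa : IsFiberwiseAmenable G)
    {T P J : Set G} {δ : ℝ} {N : ℕ} (hT : IsCompactOpen T)
    (hr : InjOn rng T) (hP : IsCompactOpen P) (hPT : P ⊆ T) (hδ : 0 < δ) (hδ1 : δ ≤ 1)
    (hTP : ∀ u ∈ unitSpace G, ((fiber T u).ncard : ℝ) ≤ 2 / δ * (fiber P u).ncard)
    (hN : 32 / δ ≤ N) (hJ : IsSmall N J (unitSpace G \ rng '' T)) :
    Embeds (unitSpace G \ rng '' T) (rng '' P) := by
  have hX := isCompactOpen_unitSpace G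
  -- If `P` were empty, so would be `T`, and the whole unit space would be small. A Følner fiber
  -- would then have at most `δ / 16` times its own number of points.
  have hne : P.Nonempty := by
    by_contra hcon
    rw [not_nonempty_iff_eq_empty] at hcon
    subst hcon
    have hTe : T = ∅ := subset_empty_iff.1 (subset_of_fiber_subset fun u hu => by
      have := hTP u hu
      simp only [fiber, mem_empty_iff_false, false_and, ofPred_false, ncard_empty, Nat.cast_zero,
        mul_zero] at this
      have h0 : (fiber T u).ncard = 0 := by exact_mod_cast le_antisymm this (Nat.cast_nonneg _)
      rw [(ncard_eq_zero (hG.finite_fiber hT u)).1 h0])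
    subst hTe
    obtain ⟨L, hL, hLF⟩ := exists_uniform_folner hG hmin hfa hJ.isCompactOpen one_pos
    obtain ⟨v, hv⟩ := hinf.nonempty
    obtain ⟨hne, hle⟩ := hLF v hv
    rw [fiber_setMul] at hle
    have hLf := hG.finite_fiber hL v
    have h1 := hJ.ncard_le hG hδ hN hLf (finite_setMul (hG.finite_fiber hJ.isCompactOpen) hLf)
      subset_rfl (by linarith)
    have hall : fiber L v ∩ rng ⁻¹' unitSpace G = fiber L v := inter_eq_left.2 fun x _ => rng_mem x
    rw [image_empty, sdiff_empty, hall] at h1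
    have h2 : (0 : ℝ) < (fiber L v).ncard := by exact_mod_cast (ncard_pos hLf).2 hne
    nlinarith
  obtain ⟨O, J₂, hO, hOne, hOP, hJ₂⟩ := exists_isSmall hG hmin hinf N hP.image_rng.2
    (by rintro _ ⟨g, -, rfl⟩; exact rng_mem g) (hne.image rng)
  have hOu : O ⊆ unitSpace G := hOP.trans (by rintro _ ⟨g, -, rfl⟩; exact rng_mem g)
  -- Invariance under `J` and `J₂` bounds the visits to `R` and `O`; invariance under `T T⁻¹` keeps
  -- the columns of `T` mostly inside each Følner column.
  set K := unitSpace G ∪ J ∪ J₂ ∪ setMul T (setInv T) with hKdef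
  have hK : IsCompactOpen K :=
    ((hX.union hJ.isCompactOpen).union hJ₂.isCompactOpen).union (hT.setMul hT.setInv)
  have hKu : unitSpace G ⊆ K := fun x hx => Or.inl (Or.inl (Or.inl hx))
  obtain ⟨T₂, hT₂, hr₂, hF, hemb⟩ := exists_folner_columns hG hmin hae hfa hK hKu
    (show 0 < δ / 16 by positivity) hO.2 hOu hOne
  set R := unitSpace G \ rng '' T with hR
  have hRco : IsCompactOpen R := hX.diff hT.image_rng
  have hYO : IsCompactOpen (rng '' P \ O) := hP.image_rng.diff hO
  have hmatch : Embeds (rng '' (T₂ ∩ rng ⁻¹' R)) (rng '' (T₂ ∩ rng ⁻¹' (rng '' P \ O))) := by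
    refine embeds_of_ncard_le hG hr₂ (hT₂.inter_rng hRco) (hT₂.inter_rng hYO) inter_subset_left
      inter_subset_left fun u hu => ?_
    rw [fiber_inter_rng, fiber_inter_rng]
    set F := fiber T₂ u with hFdef
    have hFf : F.Finite := hG.finite_fiber hT₂ u
    have hKFf : (setMul K F).Finite := finite_setMul (hG.finite_fiber hK) hFf
    have hKF := hF u hu
    have hKF2 : ((setMul K F).ncard : ℝ) ≤ 2 * F.ncard := by
      refine hKF.trans (mul_le_mul_of_nonneg_right (by linarith) (by positivity))
    have h1 := hJ.ncard_le hG hδ hN hFf hKFf (fun x hx => Or.inl (Or.inl (Or.inr hx))) hKF2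
    have h2 := hJ₂.ncard_le hG hδ hN hFf hKFf (fun x hx => Or.inl (Or.inr hx)) hKF2
    have h3 : (F.ncard : ℝ) ≤ (F ∩ rng ⁻¹' R).ncard + (F ∩ rng ⁻¹' (rng '' T)).ncard := by
      have : F ⊆ (F ∩ rng ⁻¹' R) ∪ (F ∩ rng ⁻¹' (rng '' T)) := by
        intro x hx
        by_cases hxT : rng x ∈ rng '' T
        exacts [Or.inr ⟨hx, hxT⟩, Or.inl ⟨hx, rng_mem x, hxT⟩]
      exact_mod_cast (ncard_le_ncard this ((hFf.subset inter_subset_left).union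
        (hFf.subset inter_subset_left))).trans (ncard_union_le _ _)
    have hpos : (0 : ℝ) ≤ F.ncard := by positivity
    have h4 := le_ncard_inter_rng hG hT hr hP hPT hδ hTP hK hKu (fun x hx => Or.inr hx) hFf hKF
      (by nlinarith)
    have h5 : ((F ∩ rng ⁻¹' (rng '' P)).ncard : ℝ) ≤
        (F ∩ rng ⁻¹' O).ncard + (F ∩ rng ⁻¹' (rng '' P \ O)).ncard := by
      have : F ∩ rng ⁻¹' (rng '' P) ⊆ (F ∩ rng ⁻¹' O) ∪ (F ∩ rng ⁻¹' (rng '' P \ O)) := by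
        rintro x ⟨hx, hxP⟩
        by_cases hxO : rng x ∈ O
        exacts [Or.inl ⟨hx, hxO⟩, Or.inr ⟨hx, hxP, hxO⟩]
      exact_mod_cast (ncard_le_ncard this ((hFf.subset inter_subset_left).union
        (hFf.subset inter_subset_left))).trans (ncard_union_le _ _)
    -- In units of `δ / 16 * |F|`: at most 1 in `R`, at most 1 in `O`, at least 3 in `rng '' P`,
    -- hence at least 2 outside `O`.
    have h6 : ((F ∩ rng ⁻¹' R).ncard : ℝ) ≤ (F ∩ rng ⁻¹' (rng '' P \ O)).ncard := by nlinarith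
    exact_mod_cast h6
  have hrest : Embeds (R \ rng '' T₂) O :=
    hemb.mono (hRco.diff hT₂.image_rng) (sdiff_subset_sdiff_left sdiff_subset)
  have hunion := hmatch.union hrest
    (by
      rw [image_inter_preimage]
      exact disjoint_sdiff_right.mono_left inter_subset_left)
    (by
      rw [image_inter_preimage]
      exact disjoint_sdiff_left.mono_left inter_subset_right)
  rw [image_inter_preimage, inter_comm, inter_union_sdiff] at hunion
  obtain ⟨A, hA, hs, hr', hAR, hAO⟩ := hunion
  refine ⟨A, hA, hs, hr', hAR, hAO.trans (union_subset ?_ hOP)⟩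
  rw [image_inter_preimage]
  exact inter_subset_right.trans sdiff_subset

/-- The complement of the levels of a castle is absorbed by its columns. -/
theorem exists_absorbing_columns (hG : IsAmple G) {T P : Set G}
    (hr : InjOn rng T) (hP : IsCompactOpen P) (hPT : P ⊆ T)
    (hemb : Embeds (unitSpace G \ rng '' T) (rng '' P)) :
    ∃ T', IsCompactOpen T' ∧ InjOn rng (T ∪ T') ∧ rng '' (T ∪ T') = unitSpace G ∧
      ∀ u, (fiber T' u).ncard ≤ (fiber P u).ncard := by
  obtain ⟨B, hB, hBs, hBr, hBR, hBP⟩ := hemb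
  have hmem : ∀ {g}, g ∈ setMul (setInv B) P → ∃ b ∈ B, ∃ p ∈ P, rng b = rng p ∧ b† ⋆ p = g := by
    intro g hg
    obtain ⟨q, hq, p, hp, h, rfl⟩ := mem_setMul.1 hg
    exact ⟨q†, hq, p, hp, by rw [rng_inv, h], by rw [inv_inv]⟩
  have hrng : ∀ {b p : G}, rng b = rng p → rng (b† ⋆ p) = src b := fun h => by
    rw [rng_mul (by rw [src_inv, h]), rng_inv]
  have hnot : ∀ {b}, b ∈ B → src b ∉ rng '' T := fun hb => by
    have : src _ ∈ unitSpace G \ rng '' T := hBR ▸ mem_image_of_mem src hb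
    exact this.2
  have hdis : ∀ a ∈ T, ∀ g ∈ setMul (setInv B) P, rng a ≠ rng g := by
    intro a ha g hg hag
    obtain ⟨b, hb, p, hp, h, rfl⟩ := hmem hg
    rw [hrng h] at hag
    exact hnot hb ⟨a, ha, hag⟩
  -- A missing point `src b` is attached to the column of the marked arrow `p` with `rng p = rng b`
  -- by the new arrow `b† ⋆ p`.
  refine ⟨setMul (setInv B) P, hB.setInv.setMul hP, ?_, ?_, fun u => ?_⟩
  · refine (injOn_union (Set.disjoint_left.2 fun a ha ha' => hdis a ha a ha' rfl)).2
      ⟨hr, ?_, hdis⟩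
    intro g hg g' hg' hgg'
    obtain ⟨b, hb, p, hp, h, rfl⟩ := hmem hg
    obtain ⟨b', hb', p', hp', h', rfl⟩ := hmem hg'
    rw [hrng h, hrng h'] at hgg'
    obtain rfl := hBs hb hb' hgg'
    obtain rfl := hr (hPT hp) (hPT hp') (h.symm.trans h')
    rfl
  · refine subset_antisymm (by rintro _ ⟨g, -, rfl⟩; exact rng_mem g) fun x hx => ?_
    rw [image_union]
    by_cases hxT : x ∈ rng '' T
    · exact Or.inl hxT
    · obtain ⟨b, hb, rfl⟩ : x ∈ src '' B := by rw [hBR]; exact ⟨hx, hxT⟩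
      obtain ⟨p, hp, hpb⟩ := hBP ⟨b, hb, rfl⟩
      exact Or.inr ⟨b† ⋆ p, mul_mem_setMul (inv_mem_setInv hb) hp (by rw [src_inv, hpb]),
        hrng hpb.symm⟩
  · rw [fiber_setMul]
    have := ncard_setMul_le_mul (A := setInv B) (c := 1) (hG.finite_fiber hP u) fun x _ => by
      have hsub : (fiber (setInv B) (rng x)).Subsingleton := by
        rintro a ⟨ha, hax⟩ b ⟨hb, hbx⟩
        have := hBr ha hb (by rw [rng_inv, rng_inv, hax, hbx])
        rw [← inv_inv a, this, inv_inv]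
      have := hsub.finite.to_subtype
      exact_mod_cast ncard_le_one_iff_subsingleton.2 hsub
    rw [one_mul] at this
    exact_mod_cast this

theorem isAlmostFinite_of_infinite (hG : IsAmple G) (hmin : IsMinimal G)
    (hinf : (unitSpace G).Infinite) (hae : IsAlmostElementary G) (hfa : IsFiberwiseAmenable G) :
    IsAlmostFinite G := by
  refine isAlmostFinite_of_columns hG fun K hK hKu ε hε => ?_
  have hX := isCompactOpen_unitSpace G
  obtain ⟨c, hc⟩ := hG.exists_ncard_fiber_le hK
  -- The attached points produce at most `c * δ ≤ ε / 4` times the column height in boundary, and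
  -- the boundary of the column itself costs another `ε / 4`.
  set δ : ℝ := min 1 (ε / (4 * (c + 1))) with hδdef
  have hδ : 0 < δ := lt_min one_pos (by positivity)
  have hδ1 : δ ≤ 1 := min_le_left _ _
  have hδc : c * δ ≤ ε / 4 := by
    have h1 : δ ≤ ε / (4 * (c + 1)) := min_le_right _ _
    rw [le_div_iff₀ (by positivity)] at h1
    nlinarith
  obtain ⟨N, hN⟩ := exists_nat_ge (32 / δ)
  obtain ⟨J₀, hJ₀, hJ₀N⟩ := exists_large_fibers hG hmin hinf N
  obtain ⟨O, J, hO, hOne, hOu, hJ⟩ := exists_isSmall hG hmin hinf N hX.2 subset_rfl hinf.nonempty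
  have hη : 0 < min 1 (ε / 4) := lt_min one_pos (by positivity)
  obtain ⟨T, hT, hr, hF, hemb⟩ := exists_folner_columns hG hmin hae hfa (hK.union hJ₀)
    (hKu.trans subset_union_left) hη hO.2 hOu hOne
  obtain ⟨J', hJ'⟩ := hJ.of_embeds hG hemb
  have hTf := hG.finite_fiber hT
  have hKJf := hG.finite_fiber (hK.union hJ₀)
  -- Invariance under `J₀`, whose fibers have at least `N` points, makes nonempty columns tall.
  -- Hence rounding `δ * height` down loses at most a factor of 2, the one in `2 / δ`.
  have hheight : ∀ u ∈ unitSpace G, (fiber T u).Nonempty → 1 ≤ δ * (fiber T u).ncard := by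
    intro u hu ⟨x, hx⟩
    have h1 : (N : ℝ) ≤ (setMul (K ∪ J₀) (fiber T u)).ncard := by
      have h2 := hJ₀N _ (rng_mem x)
      rw [← ncard_setMul_singleton] at h2
      exact_mod_cast h2.trans (ncard_le_ncard
        (setMul_mono subset_union_right (singleton_subset_iff.2 hx)) (finite_setMul hKJf (hTf u)))
    have h3 : 32 / δ ≤ 2 * (fiber T u).ncard := by
      refine hN.trans (h1.trans ((hF u hu).trans ?_))
      exact mul_le_mul_of_nonneg_right (by linarith [min_le_left 1 (ε / 4)]) (by positivity)
    rw [div_le_iff₀ hδ] at h3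
    linarith
  obtain ⟨P, hP, hPT, hPc⟩ := hG.exists_ncard_fiber_eq hT (fun u => ⌊δ * (fiber T u).ncard⌋₊)
    (fun u _ => by
      filter_upwards [hG.eventually_ncard_fiber hT u] with v hv
      rw [hv])
    (fun u _ => Nat.floor_le_of_le (mul_le_of_le_one_left (by positivity) hδ1))
  have hTP : ∀ u ∈ unitSpace G, ((fiber T u).ncard : ℝ) ≤ 2 / δ * (fiber P u).ncard := by
    intro u hu
    rcases (fiber T u).eq_empty_or_nonempty with he | hne
    · rw [he, ncard_empty, Nat.cast_zero]; positivity
    · rw [hPc u hu, div_mul_eq_mul_div, le_div_iff₀ hδ]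
      have h1 := hheight u hu hne
      have h2 := Nat.lt_floor_add_one (δ * (fiber T u).ncard)
      have h3 : (1 : ℝ) ≤ ⌊δ * (fiber T u).ncard⌋₊ := by
        exact_mod_cast Nat.le_floor (by simpa using h1)
      linarith
  have hRP := embeds_of_isSmall hG hmin hinf hae hfa hT hr hP hPT hδ hδ1 hTP hN hJ'
  obtain ⟨T', hT', hr', hX', hT'P⟩ := exists_absorbing_columns hG hr hP hPT hRP
  refine ⟨T ∪ T', hT.union hT', hr', hX', ?_⟩
  rintro _ ⟨g, hg, rfl⟩
  set u := src g with hu_def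
  have hu : u ∈ unitSpace G := src_mem g
  rw [fiber_union, setMul_union_right]
  have hT'f := hG.finite_fiber hT'
  have hKf := hG.finite_fiber hK
  have hPle : ((fiber P u).ncard : ℝ) ≤ δ * (fiber T u).ncard := by
    rw [hPc u hu]; exact Nat.floor_le (by positivity)
  have hT'le : ((fiber T' u).ncard : ℝ) ≤ δ * (fiber T u).ncard :=
    le_trans (by exact_mod_cast hT'P u) hPle
  have hpos : (0 : ℝ) < (fiber T u).ncard := by
    by_contra! hcon
    have h0 : (fiber T u).ncard = 0 := by exact_mod_cast le_antisymm hcon (Nat.cast_nonneg _)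
    rw [h0, Nat.cast_zero, mul_zero] at hT'le
    have h0' : (fiber T' u).ncard = 0 := by exact_mod_cast le_antisymm hT'le (Nat.cast_nonneg _)
    rw [ncard_eq_zero (hTf u)] at h0
    rw [ncard_eq_zero (hT'f u)] at h0'
    have : g ∈ fiber (T ∪ T') u := ⟨hg, rfl⟩
    rw [fiber_union, h0, h0', union_empty] at this
    exact this
  have h1 : ((setMul K (fiber T u) \ fiber T u).ncard : ℝ) ≤ ε / 4 * (fiber T u).ncard := by
    have h2 : ((setMul (K ∪ J₀) (fiber T u) \ fiber T u).ncard : ℝ) + (fiber T u).ncard =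
        (setMul (K ∪ J₀) (fiber T u)).ncard := by
      exact_mod_cast ncard_sdiff_add_ncard_of_subset
        (subset_setMul (hKu.trans subset_union_left) _) (finite_setMul hKJf (hTf u))
    have h3 : ((setMul K (fiber T u) \ fiber T u).ncard : ℝ) ≤
        (setMul (K ∪ J₀) (fiber T u) \ fiber T u).ncard := by
      exact_mod_cast ncard_le_ncard
        (sdiff_subset_sdiff_left (setMul_mono subset_union_left subset_rfl))
        (finite_setMul hKJf (hTf u)).sdiff
    have h4 := hF u hu
    have h5 : min 1 (ε / 4) * (fiber T u).ncard ≤ ε / 4 * (fiber T u).ncard :=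
      mul_le_mul_of_nonneg_right (min_le_right _ _) hpos.le
    linarith
  have h2 : ((setMul K (fiber T' u)).ncard : ℝ) ≤ ε / 4 * (fiber T u).ncard := by
    calc ((setMul K (fiber T' u)).ncard : ℝ) ≤ c * (fiber T' u).ncard :=
          ncard_setMul_le_mul (hT'f u) fun x _ => by exact_mod_cast hc _
      _ ≤ c * (δ * (fiber T u).ncard) := by gcongr
      _ = (c * δ) * (fiber T u).ncard := by ring
      _ ≤ _ := by gcongr
  have h3 : ((fiber T u).ncard : ℝ) ≤ (fiber T u ∪ fiber T' u).ncard := by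
    exact_mod_cast ncard_le_ncard subset_union_left ((hTf u).union (hT'f u))
  have h4 : (((setMul K (fiber T u) ∪ setMul K (fiber T' u)) \ (fiber T u ∪ fiber T' u)).ncard : ℝ) ≤
      (setMul K (fiber T u) \ fiber T u).ncard + (setMul K (fiber T' u)).ncard := by
    have hsub : (setMul K (fiber T u) ∪ setMul K (fiber T' u)) \ (fiber T u ∪ fiber T' u) ⊆
        (setMul K (fiber T u) \ fiber T u) ∪ setMul K (fiber T' u) := by
      rintro x ⟨hx | hx, hx'⟩
      exacts [Or.inl ⟨hx, fun h => hx' (Or.inl h)⟩, Or.inr hx]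
    exact_mod_cast (ncard_le_ncard hsub ((finite_setMul hKf (hTf u)).sdiff.union
      (finite_setMul hKf (hT'f u)))).trans (ncard_union_le _ _)
  nlinarith

/-- Over a finite unit space with at least two points an almost elementary minimal groupoid
is principal. -/
theorem injOn_rng_fiber_of_finite (hG : IsAmple G) (hmin : IsMinimal G)
    (hfin : (unitSpace G).Finite) (hnt : ¬ (unitSpace G).Subsingleton)
    (hae : IsAlmostElementary G) {v : G} (hv : v ∈ unitSpace G) (hvo : IsOpen {v}) :
    InjOn rng (fiber univ v) := by
  rintro g ⟨-, hg⟩ g' ⟨-, hg'⟩ hgg'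
  have hex : ∀ w : G, ∃ e : G, w ∈ unitSpace G → src e = w ∧ rng e = v := fun w => by
    by_cases hw : w ∈ unitSpace G
    · obtain ⟨e, he, he'⟩ := hmin.exists_arrow hvo rfl hv hw
      exact ⟨e, fun _ => ⟨he, he'⟩⟩
    · exact ⟨w, fun h => absurd h hw⟩
  choose e he using hex
  -- For any arrow `t` of the inner castle, `K` then carries `t` to both `g ⋆ e (rng t) ⋆ t` and `g'
  -- ⋆ e (rng t) ⋆ t`. These lie in `TD` with equal ranges, so `g = g'`.
  set K := unitSpace G ∪ ((fun w => g ⋆ e w) '' unitSpace G ∪ (fun w => g' ⋆ e w) '' unitSpace G)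
  have hK : IsCompact K :=
    (hfin.union ((hfin.image _).union (hfin.image _))).isCompact
  obtain ⟨TC, TD, hTC, -, hinj, hKT, A, -, -, hAr, hAX, hAv⟩ := exists_compactOpen_columns hG hae hK
    subset_union_left hvo (singleton_subset_iff.2 hv) (singleton_nonempty v)
  -- With no columns, the whole unit space would embed into the single point `v`.
  obtain ⟨t, ht⟩ : TC.Nonempty := by
    by_contra hcon
    rw [not_nonempty_iff_eq_empty] at hcon
    subst hcon
    rw [image_empty, sdiff_empty] at hAX
    refine hnt ?_
    rw [← hAX]
    rintro _ ⟨a, ha, rfl⟩ _ ⟨b, hb, rfl⟩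
    have h1 : rng a = v := hAv ⟨a, ha, rfl⟩
    have h2 : rng b = v := hAv ⟨b, hb, rfl⟩
    rw [hAr ha hb (h1.trans h2.symm)]
  obtain ⟨he1, he2⟩ := he (rng t) (rng_mem t)
  have hge : src g = rng (e (rng t)) := hg.trans he2.symm
  have hge' : src g' = rng (e (rng t)) := hg'.trans he2.symm
  have hs : src (g ⋆ e (rng t)) = rng t := by rw [src_mul hge, he1]
  have hs' : src (g' ⋆ e (rng t)) = rng t := by rw [src_mul hge', he1]
  have h1 := hKT (mul_mem_setMul (Or.inr (Or.inl ⟨rng t, rng_mem t, rfl⟩)) ht hs)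
  have h2 := hKT (mul_mem_setMul (Or.inr (Or.inr ⟨rng t, rng_mem t, rfl⟩)) ht hs')
  have h3 := hinj h1 h2 (by rw [rng_mul hs, rng_mul hs', rng_mul hge, rng_mul hge', hgg'])
  exact mul_right_cancel hge hge' (mul_right_cancel hs hs' h3)

theorem isAlmostFinite_of_finite (hG : IsAmple G) (hmin : IsMinimal G)
    (hfin : (unitSpace G).Finite) (hgroup : (unitSpace G).Subsingleton → unitSpace G = univ)
    (hae : IsAlmostElementary G) : IsAlmostFinite G := by
  have hX := isCompactOpen_unitSpace G
  refine isAlmostFinite_of_columns hG fun K _ _ ε hε => ?_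
  -- Columns that are full source fibers have no outer boundary at all, for any `K`.
  have key : ∀ T : Set G, (∀ u, (fiber T u).Finite) →
      (∀ u ∈ src '' T, fiber univ u ⊆ fiber T u) → ∀ u ∈ src '' T,
      ((setMul K (fiber T u) \ fiber T u).ncard : ℝ) < ε * (fiber T u).ncard := by
    intro T hTf hT u hu
    have he : setMul K (fiber T u) \ fiber T u = ∅ := by
      rw [sdiff_eq_empty, ← fiber_setMul]
      exact (fiber_mono (subset_univ _) u).trans (hT u hu)
    obtain ⟨t, ht, rfl⟩ := hu
    have : 0 < (fiber T (src t)).ncard := (ncard_pos (hTf _)).2 ⟨t, ht, rfl⟩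
    rw [he, ncard_empty, Nat.cast_zero]
    positivity
  by_cases hs : (unitSpace G).Subsingleton
  · refine ⟨unitSpace G, hX, injOn_rng_unitSpace, ?_, key _ (hG.finite_fiber hX) fun u _ => ?_⟩
    · ext x
      exact ⟨by rintro ⟨g, -, rfl⟩; exact rng_mem g, fun hx => ⟨x, hx, rng_unit hx⟩⟩
    · rw [hgroup hs]
  · obtain ⟨v, hv, -⟩ := not_subsingleton_iff.1 hs
    have hvo : IsOpen {v} := by
      convert hX.2.inter (hfin.subset (sdiff_subset (t := {v}))).isClosed.isOpen_compl using 1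
      ext x
      constructor
      · rintro rfl
        exact ⟨hv, fun h => h.2 rfl⟩
      · rintro ⟨hx, hx'⟩
        by_contra hne
        exact hx' ⟨hx, hne⟩
    have hinj := injOn_rng_fiber_of_finite hG hmin hfin hs hae hv hvo
    have hTfin : (fiber univ v).Finite := Set.Finite.of_finite_image
      (hfin.subset (by rintro _ ⟨g, -, rfl⟩; exact rng_mem g)) hinj
    refine ⟨fiber univ v, ⟨hTfin.isCompact, ?_⟩, hinj, ?_,
      key _ (fun u => hTfin.subset (fiber_subset _ _)) ?_⟩
    · convert hvo.preimage continuous_src using 1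
      ext g
      exact ⟨fun h => h.2, fun h => ⟨mem_univ g, h⟩⟩
    · refine subset_antisymm (by rintro _ ⟨g, -, rfl⟩; exact rng_mem g) fun w hw => ?_
      obtain ⟨g, hg, hgv⟩ := hmin.exists_arrow hvo rfl hv hw
      exact ⟨g†, ⟨mem_univ _, by rw [src_inv]; exact hgv⟩, by rw [rng_inv, hg]⟩
    · rintro _ ⟨t, ht, rfl⟩ g hg
      exact ⟨⟨mem_univ g, hg.2.trans ht.2⟩, hg.2⟩

end Main

end EtaleGpd

theorem proposition7p01 (G : Type*) [TopologicalSpace G] [LocallyCompactSpace G] [T2Space G]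
    [SigmaCompactSpace G] [ArrowGroupoid G] [IsEtale G]
    [CompactSpace (unitSpace G)] [TopologicalSpace.MetrizableSpace (unitSpace G)]
    (hample : IsAmple G) (hmin : IsMinimal G)
    (hgroup : (unitSpace G).Subsingleton → unitSpace G = Set.univ)
    (hae : IsAlmostElementary G) (hfa : IsFiberwiseAmenable G) :
    IsAlmostFinite G := by
  rcases (unitSpace G).finite_or_infinite with hfin | hinf
  · exact isAlmostFinite_of_finite hample hmin hfin hgroup hae
  · exact isAlmostFinite_of_infinite hample hmin hinf hae hfa
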